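/- Let $(\mathcal M,g)$ be a spacetime: a connected, oriented and time-oriented smooth four-dimensional manifold with a $C^3$ metric of signature $(-,+,+,+)$, Levi-Civita connection $\nabla$ and volume form $\eta$; "smooth" for tensor fields means $C^3$. Assume that $g$ is vacuum, i.e. Ricci-flat, and let $\xi$ be a smooth Killing vector field. Put $F_{\alpha\beta}=\nabla_\alpha\xi_\beta$, $F^\star_{\alpha\beta}=\tfrac12\eta_{\alpha\beta\mu\nu}F^{\mu\nu}$ and $\mathcal F_{\alpha\beta}=F_{\alpha\beta}+iF^\star_{\alpha\beta}$ (the self-dual Killing form), and let $\mathcal C_{\alpha\beta\mu\nu}=C_{\alpha\beta\mu\nu}+\tfrac i2\eta_{\mu\nu\rho\sigma}C_{\alpha\beta}{}^{\rho\sigma}$ be the self-dual Weyl tensor. Assume that $\mathcal F$ vanishes at no point, that it is null, i.e. $\mathcal F_{\alpha\beta}\mathcal F^{\alpha\beta}=0$, and that $$\mathcal C_{\alpha\beta\mu\nu}=Q\,\mathcal F_{\alpha\beta}\mathcal F_{\mu\nu}$$ for some function $Q:\mathcal M\to\mathbb C$. Then: 1. Every point of $\mathcal M$ has an open neighbourhood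 $U$ carrying a smooth, nowhere zero, null vector field $k$ that is parallel ($\nabla k=0$), commutes with $\xi$ ($[\xi,k]=0$), and for which $g(\xi,k)$ is constant on $U$. 2. Suppose that $k$ is such a vector field on some non-empty open set $U\subset\mathcal M$ and that the constant $c=g(\xi,k)$ is non-zero. Then $k$ is, up to the constant factor $-1/c$, the restriction of a globally defined field: there is a smooth, nowhere zero, null and parallel vector field $K$ on all of $\mathcal M$ with $[\xi,K]=0$, $g(\xi,K)=-1$ everywhere and $K=-c^{-1}k$ on $U$. In particular, $\xi$ vanishes nowhere on $\mathcal M$. -/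

import Mathlib

open scoped Manifold ContDiff

/-- The model space of a four-dimensional manifold. -/
abbrev E4 : Type := EuclideanSpace ℝ (Fin 4)

noncomputable section

/-! ### Tensor calculus on an open set of coordinates

`G y` is the matrix `g_{ab}` of the metric components at the coordinate point `y`, and
`X y a` is the contravariant component `X^a` of a vector field. -/

namespace Coord

/-- The partial derivative `∂_a f`. -/
def pd (a : Fin 4) (f : E4 → ℝ) (y : E4) : ℝ :=
  fderiv ℝ f y (EuclideanSpace.single a 1)

/-- The Christoffel symbol `Γ^a_{bc}` of the Levi-Civita connection. -/
def christoffel (G : E4 → Matrix (Fin 4) (Fin 4) ℝ) (y : E4) (a b c : Fin 4) : ℝ :=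
  (1 / 2) * ∑ d, (G y)⁻¹ a d *
    (pd b (fun z => G z d c) y + pd c (fun z => G z d b) y - pd d (fun z => G z b c) y)

/-- `∇_a X^b` for a vector field `X`. -/
def covDeriv (G : E4 → Matrix (Fin 4) (Fin 4) ℝ) (X : E4 → Fin 4 → ℝ) (y : E4)
    (a b : Fin 4) : ℝ :=
  pd a (fun z => X z b) y + ∑ c, christoffel G y b a c * X y c

/-- The covariant components `X_b = g_{bc} X^c`. -/
def lower (G : E4 → Matrix (Fin 4) (Fin 4) ℝ) (X : E4 → Fin 4 → ℝ) (y : E4) (b : Fin 4) : ℝ :=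
  ∑ c, G y b c * X y c

/-- `∇_a X_b = ∂_a X_b - Γ^c_{ab} X_c`. -/
def covDerivLower (G : E4 → Matrix (Fin 4) (Fin 4) ℝ) (X : E4 → Fin 4 → ℝ) (y : E4)
    (a b : Fin 4) : ℝ :=
  pd a (fun z => lower G X z b) y - ∑ c, christoffel G y c a b * lower G X y c

/-- The Riemann tensor `R_{abcd}`. -/
def riemann (G : E4 → Matrix (Fin 4) (Fin 4) ℝ) (y : E4) (a b c d : Fin 4) : ℝ :=
  ∑ r, G y a r *
    (pd c (fun z => christoffel G z r d b) y - pd d (fun z => christoffel G z r c b) y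
      + ∑ s, (christoffel G y r c s * christoffel G y s d b
        - christoffel G y r d s * christoffel G y s c b))

/-- The Ricci tensor `R_{bd} = g^{ac} R_{abcd}`. -/
def ricci (G : E4 → Matrix (Fin 4) (Fin 4) ℝ) (y : E4) (b d : Fin 4) : ℝ :=
  ∑ a, ∑ c, (G y)⁻¹ a c * riemann G y a b c d

/-- The scalar curvature. -/
def scalarCurv (G : E4 → Matrix (Fin 4) (Fin 4) ℝ) (y : E4) : ℝ :=
  ∑ b, ∑ d, (G y)⁻¹ b d * ricci G y b d

/-- The Weyl tensor `C_{abcd}` in dimension four. -/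
def weyl (G : E4 → Matrix (Fin 4) (Fin 4) ℝ) (y : E4) (a b c d : Fin 4) : ℝ :=
  riemann G y a b c d
    - (1 / 2) * (G y a c * ricci G y b d - G y a d * ricci G y b c
      - G y b c * ricci G y a d + G y b d * ricci G y a c)
    + scalarCurv G y / 6 * (G y a c * G y b d - G y a d * G y b c)

/-- The Levi-Civita permutation symbol, with `ε_{0123} = 1`. -/
def epsilon (a b c d : Fin 4) : ℝ :=
  (Matrix.of fun i j : Fin 4 => if ![a, b, c, d] i = j then (1 : ℝ) else 0).det

/-- The volume form `η_{abcd}` of the Lorentzian metric `G`; `s` is `1` if the coordinates are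
positively oriented and `-1` if they are negatively oriented. -/
def volumeForm (G : E4 → Matrix (Fin 4) (Fin 4) ℝ) (s : ℝ) (y : E4) (a b c d : Fin 4) : ℝ :=
  s * √(-(G y).det) * epsilon a b c d

/-- The Hodge dual `F⋆_{ab} = (1/2) η_{abcd} F^{cd}` of a two-form. -/
def hodge (G : E4 → Matrix (Fin 4) (Fin 4) ℝ) (s : ℝ) (y : E4) (F : Fin 4 → Fin 4 → ℝ)
    (a b : Fin 4) : ℝ :=
  (1 / 2) * ∑ c, ∑ d, volumeForm G s y a b c d *
    ∑ p, ∑ q, (G y)⁻¹ c p * (G y)⁻¹ d q * F p q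

/-- The self-dual Killing form `ℱ_{ab} = F_{ab} + i F⋆_{ab}`, with `F_{ab} = ∇_a ξ_b`. -/
def killingForm (G : E4 → Matrix (Fin 4) (Fin 4) ℝ) (s : ℝ) (X : E4 → Fin 4 → ℝ) (y : E4)
    (a b : Fin 4) : ℂ :=
  (covDerivLower G X y a b : ℂ) + Complex.I * (hodge G s y (covDerivLower G X y) a b : ℂ)

/-- The square `ℱ_{ab} ℱ^{ab}` of a complex two-form. -/
def formSq (G : E4 → Matrix (Fin 4) (Fin 4) ℝ) (y : E4) (F : Fin 4 → Fin 4 → ℂ) : ℂ :=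
  ∑ a, ∑ b, ∑ c, ∑ d, (((G y)⁻¹ a c * (G y)⁻¹ b d : ℝ) : ℂ) * F a b * F c d

/-- The self-dual Weyl tensor `𝒞_{abcd} = C_{abcd} + i C⋆_{abcd}`, with the dual taken in the
last two indices. -/
def selfDualWeyl (G : E4 → Matrix (Fin 4) (Fin 4) ℝ) (s : ℝ) (y : E4)
    (a b c d : Fin 4) : ℂ :=
  (weyl G y a b c d : ℂ) + Complex.I * (hodge G s y (weyl G y a b) c d : ℂ)

end Coord

/-! ### Spacetimes -/

section Manifold

variable (M : Type*) [TopologicalSpace M] [ChartedSpace E4 M] [IsManifold (𝓡 4) ∞ M]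

/-- An orientation of a four-dimensional manifold: it tells for every smooth chart `e` and every
point `x` of its domain whether `e` is positively (`sign e x = 1`) or negatively
(`sign e x = -1`) oriented at `x`. This is locally constant in `x`, and two charts have the same
sign at `x` exactly if their transition map has positive Jacobian determinant there. -/
structure ManifoldOrientation where
  sign : OpenPartialHomeomorph M E4 → M → ℝ
  sign_eq : ∀ e ∈ IsManifold.maximalAtlas (𝓡 4) ∞ M, ∀ x ∈ e.source,
    sign e x = 1 ∨ sign e x = -1
  continuousOn_sign : ∀ e ∈ IsManifold.maximalAtlas (𝓡 4) ∞ M, ContinuousOn (sign e) e.source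
  compatible : ∀ e ∈ IsManifold.maximalAtlas (𝓡 4) ∞ M,
    ∀ e' ∈ IsManifold.maximalAtlas (𝓡 4) ∞ M, ∀ x ∈ e.source ∩ e'.source,
      0 < sign e x * sign e' x * (fderiv ℝ (e' ∘ e.symm) (e x)).det

/-- A `C^3` Lorentzian metric on an oriented and time oriented four-dimensional manifold. The
time orientation is represented by a continuous timelike vector field. -/
structure Spacetime where
  metric (x : M) : TangentSpace (𝓡 4) x →L[ℝ] TangentSpace (𝓡 4) x →L[ℝ] ℝ
  contMDiff_metric : ContMDiff (𝓡 4) ((𝓡 4).prod 𝓘(ℝ, E4 →L[ℝ] E4 →L[ℝ] ℝ)) 3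
    (fun x => Bundle.TotalSpace.mk' (E4 →L[ℝ] E4 →L[ℝ] ℝ)
      (E := fun x : M => TangentSpace (𝓡 4) x →L[ℝ] TangentSpace (𝓡 4) x →L[ℝ] ℝ) x (metric x))
  symm : ∀ (x : M) (v w : TangentSpace (𝓡 4) x), metric x v w = metric x w v
  lorentzian : ∀ x : M, ∃ b : Module.Basis (Fin 4) ℝ (TangentSpace (𝓡 4) x), ∀ i j,
    metric x (b i) (b j) = if i = j then (if i = 0 then -1 else 1) else 0
  orientation : ManifoldOrientation M
  timeField (x : M) : TangentSpace (𝓡 4) x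
  continuous_timeField : Continuous (fun x => (⟨x, timeField x⟩ : TangentBundle (𝓡 4) M))
  timelike : ∀ x : M, metric x (timeField x) (timeField x) < 0

variable {M}

/-- The components `X^a` of a vector field in the chart `e`, as functions of the coordinates. -/
def vectorComp (e : OpenPartialHomeomorph M E4) (X : ∀ x : M, TangentSpace (𝓡 4) x)
    (y : E4) (a : Fin 4) : ℝ :=
  let v : E4 := mfderiv (𝓡 4) (𝓡 4) e (e.symm y) (X (e.symm y))
  v a

/-- The coordinate vector `∂_a` of the chart `e` at the point with coordinates `y`. -/
def coordVector (e : OpenPartialHomeomorph M E4) (y : E4) (a : Fin 4) :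
    TangentSpace (𝓡 4) (e.symm y) :=
  mfderiv (𝓡 4) (𝓡 4) e.symm y (EuclideanSpace.single a 1 : E4)

namespace Spacetime

variable (S : Spacetime M)

/-- The metric components `g_{ab} = g(∂_a, ∂_b)` in the chart `e`. -/
def comp (e : OpenPartialHomeomorph M E4) (y : E4) : Matrix (Fin 4) (Fin 4) ℝ :=
  Matrix.of fun a b => S.metric (e.symm y) (coordVector e y a) (coordVector e y b)

/-- The components of the self-dual Killing form of `ξ` in the chart `e`. -/
def killingForm (ξ : ∀ x : M, TangentSpace (𝓡 4) x) (e : OpenPartialHomeomorph M E4) (y : E4) :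
    Fin 4 → Fin 4 → ℂ :=
  Coord.killingForm (S.comp e) (S.orientation.sign e (e.symm y)) (vectorComp e ξ) y

/-- The components of the self-dual Weyl tensor in the chart `e`. -/
def selfDualWeyl (e : OpenPartialHomeomorph M E4) (y : E4) :
    Fin 4 → Fin 4 → Fin 4 → Fin 4 → ℂ :=
  Coord.selfDualWeyl (S.comp e) (S.orientation.sign e (e.symm y)) y

/-- Vacuum (without cosmological constant): the Ricci tensor vanishes. -/
def IsVacuum : Prop :=
  ∀ e ∈ IsManifold.maximalAtlas (𝓡 4) ∞ M, ∀ y ∈ e.target, ∀ a b,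
    Coord.ricci (S.comp e) y a b = 0

/-- `ξ` is a `C^3` vector field with `∇_a ξ_b + ∇_b ξ_a = 0`. -/
def IsKilling (ξ : ∀ x : M, TangentSpace (𝓡 4) x) : Prop :=
  ContMDiff (𝓡 4) (𝓡 4).tangent 3 (fun x => (⟨x, ξ x⟩ : TangentBundle (𝓡 4) M)) ∧
  ∀ e ∈ IsManifold.maximalAtlas (𝓡 4) ∞ M, ∀ y ∈ e.target, ∀ a b,
    Coord.covDerivLower (S.comp e) (vectorComp e ξ) y a b
      + Coord.covDerivLower (S.comp e) (vectorComp e ξ) y b a = 0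

/-- The self-dual Killing form is null: `ℱ_{ab} ℱ^{ab} = 0`. -/
def KillingFormNull (ξ : ∀ x : M, TangentSpace (𝓡 4) x) : Prop :=
  ∀ e ∈ IsManifold.maximalAtlas (𝓡 4) ∞ M, ∀ y ∈ e.target,
    Coord.formSq (S.comp e) y (S.killingForm ξ e y) = 0

/-- The self-dual Killing form vanishes at no point. -/
def KillingFormNowhereZero (ξ : ∀ x : M, TangentSpace (𝓡 4) x) : Prop :=
  ∀ e ∈ IsManifold.maximalAtlas (𝓡 4) ∞ M, ∀ y ∈ e.target, S.killingForm ξ e y ≠ 0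

/-- The alignment condition `𝒞_{abcd} = Q ℱ_{ab} ℱ_{cd}`. -/
def WeylAligned (ξ : ∀ x : M, TangentSpace (𝓡 4) x) (Q : M → ℂ) : Prop :=
  ∀ e ∈ IsManifold.maximalAtlas (𝓡 4) ∞ M, ∀ y ∈ e.target, ∀ a b c d,
    S.selfDualWeyl e y a b c d
      = Q (e.symm y) * S.killingForm ξ e y a b * S.killingForm ξ e y c d

/-- `k` is on `U` a `C^3`, null (in particular nowhere zero) and parallel vector field. The
values of `k` outside `U` are irrelevant. -/
structure IsNullParallelOn (k : ∀ x : M, TangentSpace (𝓡 4) x) (U : Set M) : Prop where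
  contMDiffOn :
    ContMDiffOn (𝓡 4) (𝓡 4).tangent 3 (fun x => (⟨x, k x⟩ : TangentBundle (𝓡 4) M)) U
  ne_zero : ∀ x ∈ U, k x ≠ 0
  null : ∀ x ∈ U, S.metric x (k x) (k x) = 0
  parallel : ∀ e ∈ IsManifold.maximalAtlas (𝓡 4) ∞ M, ∀ y ∈ e.target, e.symm y ∈ U →
    ∀ a b, Coord.covDeriv (S.comp e) (vectorComp e k) y a b = 0

end Spacetime

end Manifold

end

noncomputable section

open Matrix

namespace Coord

/-! ### Null self-dual two-forms at a point -/

/-! At a point the null form `ℱ = F + iF⋆` has electric and magnetic parts of equal length and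
orthogonal to each other. It therefore has one repeated principal null direction `l`, with `F_{ac}
F_b{}^c = l_a l_b`, and `l` is annihilated by both `F` and `F⋆`. Conversely, a null vector
annihilated by `F` is a multiple of `l` (`exists_isNullDirection`).

Every Killing field satisfies `∇_c F_{ab} = R_{rcab} ξ^r`. In vacuum the Riemann tensor is the Weyl
tensor, hence the real part of `Q ℱ ℱ`. So `∇_c ℱ` is a complex one-form times `ℱ`, and `T = l ⊗ l`
is recurrent with a real factor (`exists_pd_energy`). The tensor `T` is a smooth expression in `F`,
whereas `l` is only given pointwise; dividing a column of `T` by its diagonal entry gives a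
differentiable one-form along `l`, again recurrent. Since `l` is annihilated by `ℱ`, its contraction
with the curvature vanishes, and the Ricci identity makes the recurrence form closed. A local
primitive `φ` of it rescales the null form to a parallel one (`IsNullAligned.exists_parallel`). Here
`Q` is used only through its values and is never differentiated.

For a parallel `k` both remaining properties amount to `F k = 0`: torsion-freeness gives `[ξ,k] =
-∇_k ξ`, and `∇_a (ξ_b k^b) = F_{ab} k^b`.

For the global statement, two parallel null fields commuting with `ξ` both lie along `l`, so they
are proportional at every common point (`IsNullParallelOn.exists_eq_smul`). If `g(ξ,k)` is non-zero
for one of them it is non-zero for every other one at each common point; the set of points where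
this holds is open and closed, hence everything by connectedness. The normalization `g(ξ,K) = -1`
then removes the scaling freedom, and the local fields agree on overlaps. -/

theorem det_four (M : Matrix (Fin 4) (Fin 4) ℝ) : M.det =
    (M 0 0 * M 1 1 - M 0 1 * M 1 0) * (M 2 2 * M 3 3 - M 2 3 * M 3 2)
    - (M 0 0 * M 1 2 - M 0 2 * M 1 0) * (M 2 1 * M 3 3 - M 2 3 * M 3 1)
    + (M 0 0 * M 1 3 - M 0 3 * M 1 0) * (M 2 1 * M 3 2 - M 2 2 * M 3 1)
    + (M 0 1 * M 1 2 - M 0 2 * M 1 1) * (M 2 0 * M 3 3 - M 2 3 * M 3 0)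
    - (M 0 1 * M 1 3 - M 0 3 * M 1 1) * (M 2 0 * M 3 2 - M 2 2 * M 3 0)
    + (M 0 2 * M 1 3 - M 0 3 * M 1 2) * (M 2 0 * M 3 1 - M 2 1 * M 3 0) := by
  rw [Matrix.det_succ_row_zero]
  simp [Fin.sum_univ_four, Matrix.det_fin_three, Fin.succAbove]
  ring

/-- The dual `(1/2) ε_{abcd} A^{cd}` with respect to the permutation symbol. -/
def epsDual (A : Matrix (Fin 4) (Fin 4) ℝ) : Matrix (Fin 4) (Fin 4) ℝ :=
  Matrix.of fun a b => (1 / 2) * ∑ c, ∑ d, epsilon a b c d * A c d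

theorem epsDual_eq (A : Matrix (Fin 4) (Fin 4) ℝ) :
    epsDual A = (1 / 2 : ℝ) •
      !![0, A 2 3 - A 3 2, A 3 1 - A 1 3, A 1 2 - A 2 1;
        A 3 2 - A 2 3, 0, A 0 3 - A 3 0, A 2 0 - A 0 2;
        A 1 3 - A 3 1, A 3 0 - A 0 3, 0, A 0 1 - A 1 0;
        A 2 1 - A 1 2, A 0 2 - A 2 0, A 1 0 - A 0 1, 0] := by
  ext a b
  simp only [epsDual, epsilon, det_four, Matrix.of_apply, Matrix.cons_val, Fin.sum_univ_four,
    Fin.isValue, Fin.reduceEq, if_true, if_false]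
  fin_cases a <;> fin_cases b <;> simp <;> ring

/-- The permutation symbol is a tensor density: contracting all four of its indices with `M`
multiplies it by `M.det`. This turns the Hodge dual in coordinates into the one in an orthonormal
frame. -/
theorem transpose_mul_epsDual_mul (M A : Matrix (Fin 4) (Fin 4) ℝ) :
    Mᵀ * epsDual (M * A * Mᵀ) * M = M.det • epsDual A := by
  rw [epsDual_eq, epsDual_eq, det_four]
  ext a b
  simp only [Matrix.mul_apply, Fin.sum_univ_four, Matrix.smul_apply, Matrix.transpose_apply,
    Matrix.of_apply, Matrix.cons_val, smul_eq_mul]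
  fin_cases a <;> fin_cases b <;>
    simp only [Matrix.cons_val, Fin.zero_eta, Fin.mk_one, Fin.reduceFinMk] <;> ring

/-- The two-form with electric part `x` and magnetic part `y` in an orthonormal frame. -/
def twoForm (x₁ x₂ x₃ y₁ y₂ y₃ : ℝ) : Matrix (Fin 4) (Fin 4) ℝ :=
  !![0, x₁, x₂, x₃; -x₁, 0, y₃, -y₂; -x₂, -y₃, 0, y₁; -x₃, y₂, -y₁, 0]

/-- The Minkowski metric. -/
def minkowski : Matrix (Fin 4) (Fin 4) ℝ :=
  !![-1, 0, 0, 0; 0, 1, 0, 0; 0, 0, 1, 0; 0, 0, 0, 1]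

theorem eq_twoForm_of_antisymm {F : Matrix (Fin 4) (Fin 4) ℝ} (hF : Fᵀ = -F) :
    F = twoForm (F 0 1) (F 0 2) (F 0 3) (F 2 3) (F 3 1) (F 1 2) := by
  have h : ∀ a b, F b a = -F a b := fun a b => congrFun₂ hF a b
  ext a b
  fin_cases a <;> fin_cases b <;> simp [twoForm] <;> linarith [h 0 0, h 1 1, h 2 2, h 3 3, h 0 1,
    h 0 2, h 0 3, h 1 2, h 1 3, h 2 3]

theorem epsDual_minkowski_twoForm (x₁ x₂ x₃ y₁ y₂ y₃ : ℝ) :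
    epsDual (minkowski * twoForm x₁ x₂ x₃ y₁ y₂ y₃ * minkowski) =
      twoForm y₁ y₂ y₃ (-x₁) (-x₂) (-x₃) := by
  rw [epsDual_eq]
  ext a b
  simp only [Matrix.mul_apply, Fin.sum_univ_four, minkowski, twoForm, Matrix.smul_apply,
    Matrix.of_apply, Matrix.cons_val, smul_eq_mul]
  fin_cases a <;> fin_cases b <;>
    simp only [Matrix.cons_val, Fin.zero_eta, Fin.mk_one, Fin.reduceFinMk] <;> ring

/-- The vector `l` spans the repeated principal null direction of the two-form `F` with dual `D`;
`g` is the metric and `gi` its inverse. -/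
structure IsNullDirection (g gi F D : Matrix (Fin 4) (Fin 4) ℝ) (l : Fin 4 → ℝ) : Prop where
  ne_zero : l ≠ 0
  energy : F * gi * Fᵀ = vecMulVec (g *ᵥ l) (g *ᵥ l)
  mulVec_eq_zero : F *ᵥ l = 0
  dual_mulVec_eq_zero : D *ᵥ l = 0
  null : l ⬝ᵥ g *ᵥ l = 0
  energy_dual : F * gi * Dᵀ + D * gi * Fᵀ = 0
  exists_smul : ∀ v, F *ᵥ v = 0 → v ⬝ᵥ g *ᵥ v = 0 → ∃ c : ℝ, v = c • l

theorem exists_isNullDirection_twoForm {x₁ x₂ x₃ y₁ y₂ y₃ : ℝ}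
    (h : x₁ ^ 2 + x₂ ^ 2 + x₃ ^ 2 = y₁ ^ 2 + y₂ ^ 2 + y₃ ^ 2)
    (h' : x₁ * y₁ + x₂ * y₂ + x₃ * y₃ = 0) (hx : x₁ ^ 2 + x₂ ^ 2 + x₃ ^ 2 ≠ 0) :
    ∃ l, IsNullDirection minkowski minkowski (twoForm x₁ x₂ x₃ y₁ y₂ y₃)
      (twoForm y₁ y₂ y₃ (-x₁) (-x₂) (-x₃)) l := by
  obtain ⟨r, hr, hr2⟩ : ∃ r : ℝ, r ≠ 0 ∧ r ^ 2 = x₁ ^ 2 + x₂ ^ 2 + x₃ ^ 2 := by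
    have h0 : 0 ≤ x₁ ^ 2 + x₂ ^ 2 + x₃ ^ 2 := by positivity
    exact ⟨√(x₁ ^ 2 + x₂ ^ 2 + x₃ ^ 2), by rwa [Real.sqrt_ne_zero h0], Real.sq_sqrt h0⟩
  -- `z = (x × y) / r` completes `x`, `y` to an orthogonal triple of vectors of the same length `r`;
  -- the identities below are its cyclic vector products.
  obtain ⟨z₁, hz₁⟩ : ∃ z, r * z = x₂ * y₃ - x₃ * y₂ := ⟨_, mul_div_cancel₀ _ hr⟩
  obtain ⟨z₂, hz₂⟩ : ∃ z, r * z = x₃ * y₁ - x₁ * y₃ := ⟨_, mul_div_cancel₀ _ hr⟩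
  obtain ⟨z₃, hz₃⟩ : ∃ z, r * z = x₁ * y₂ - x₂ * y₁ := ⟨_, mul_div_cancel₀ _ hr⟩
  have hy2 : r ^ 2 = y₁ ^ 2 + y₂ ^ 2 + y₃ ^ 2 := hr2.trans h
  have hyz₁ : x₃ * z₂ - x₂ * z₃ = r * y₁ := mul_left_cancel₀ hr <| by
    linear_combination x₃ * hz₂ - x₂ * hz₃ - y₁ * hr2 - x₁ * h'
  have hyz₂ : x₁ * z₃ - x₃ * z₁ = r * y₂ := mul_left_cancel₀ hr <| by
    linear_combination x₁ * hz₃ - x₃ * hz₁ - y₂ * hr2 - x₂ * h'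
  have hyz₃ : x₂ * z₁ - x₁ * z₂ = r * y₃ := mul_left_cancel₀ hr <| by
    linear_combination x₂ * hz₁ - x₁ * hz₂ - y₃ * hr2 - x₃ * h'
  have hxz₁ : y₂ * z₃ - y₃ * z₂ = r * x₁ := mul_left_cancel₀ hr <| by
    linear_combination y₂ * hz₃ - y₃ * hz₂ - x₁ * hy2 - y₁ * h'
  have hxz₂ : y₃ * z₁ - y₁ * z₃ = r * x₂ := mul_left_cancel₀ hr <| by
    linear_combination y₃ * hz₁ - y₁ * hz₃ - x₂ * hy2 - y₂ * h'
  have hxz₃ : y₁ * z₂ - y₂ * z₁ = r * x₃ := mul_left_cancel₀ hr <| by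
    linear_combination y₁ * hz₂ - y₂ * hz₁ - x₃ * hy2 - y₃ * h'
  have hx : x₁ * z₁ + x₂ * z₂ + x₃ * z₃ = 0 := mul_left_cancel₀ hr <| by
    linear_combination x₁ * hz₁ + x₂ * hz₂ + x₃ * hz₃
  have hy : y₁ * z₁ + y₂ * z₂ + y₃ * z₃ = 0 := mul_left_cancel₀ hr <| by
    linear_combination y₁ * hz₁ + y₂ * hz₂ + y₃ * hz₃
  have hzz : z₁ ^ 2 + z₂ ^ 2 + z₃ ^ 2 = r ^ 2 := mul_left_cancel₀ hr <| by
    linear_combination z₁ * hz₁ + z₂ * hz₂ + z₃ * hz₃ + x₁ * hxz₁ + x₂ * hxz₂ + x₃ * hxz₃ - r * hr2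
  -- completeness of the orthonormal triple `x / r`, `y / r`, `z / r`
  have hc : !![x₁, x₂, x₃; y₁, y₂, y₃; z₁, z₂, z₃]ᵀ * !![x₁, x₂, x₃; y₁, y₂, y₃; z₁, z₂, z₃]
      = (r ^ 2) • (1 : Matrix (Fin 3) (Fin 3) ℝ) := by
    have h1 : ((r ^ 2)⁻¹ • !![x₁, x₂, x₃; y₁, y₂, y₃; z₁, z₂, z₃]) *
        !![x₁, x₂, x₃; y₁, y₂, y₃; z₁, z₂, z₃]ᵀ = 1 := by
      rw [Matrix.smul_mul, inv_smul_eq_iff₀ (pow_ne_zero 2 hr)]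
      ext a b
      fin_cases a <;> fin_cases b <;> simp [Matrix.mul_apply, Fin.sum_univ_three] <;> linarith
    rw [mul_eq_one_comm, Matrix.mul_smul, inv_smul_eq_iff₀ (pow_ne_zero 2 hr)] at h1
    exact h1
  have hcomp := fun a b => congrFun₂ hc a b
  simp only [Matrix.mul_apply, Matrix.transpose_apply, Fin.sum_univ_three, Matrix.of_apply,
    Matrix.cons_val, Matrix.smul_apply, smul_eq_mul] at hcomp
  have h11 := hcomp 0 0
  have h22 := hcomp 1 1
  have h33 := hcomp 2 2
  have h12 := hcomp 0 1
  have h13 := hcomp 0 2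
  have h23 := hcomp 1 2
  simp at h11 h22 h33 h12 h13 h23
  -- The energy tensor has `T_{00} = r²` and `T_{0i} = r z_i`, so the covector is `(r, z)`; raising
  -- its index flips the sign of the time component.
  refine ⟨![-r, z₁, z₂, z₃], ?_, ?_, ?_, ?_, ?_, ?_, ?_⟩
  · intro h0
    exact hr (by simpa using congrFun h0 0)
  · ext a b
    simp only [twoForm, minkowski, Matrix.mul_apply, Fin.sum_univ_four, vecMulVec_apply,
      Matrix.mulVec, dotProduct, Matrix.of_apply, Matrix.cons_val, Matrix.transpose_apply]
    fin_cases a <;> fin_cases b <;>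
      simp only [Matrix.cons_val, Fin.zero_eta, Fin.mk_one, Fin.reduceFinMk] <;> linarith
  · ext a
    fin_cases a <;> simp [twoForm, Fin.sum_univ_four, Matrix.mulVec, dotProduct] <;> linarith
  · ext a
    fin_cases a <;> simp [twoForm, Fin.sum_univ_four, Matrix.mulVec, dotProduct] <;> linarith
  · simp [minkowski, Fin.sum_univ_four, Matrix.mulVec, dotProduct]
    linarith
  · ext a b
    simp only [twoForm, minkowski, Matrix.mul_apply, Fin.sum_univ_four, Matrix.add_apply,
      Matrix.of_apply, Matrix.cons_val, Matrix.transpose_apply, Matrix.zero_apply]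
    fin_cases a <;> fin_cases b <;>
      simp only [Matrix.cons_val, Fin.zero_eta, Fin.mk_one, Fin.reduceFinMk] <;> linarith
  · intro v hv hv'
    refine ⟨- v 0 / r, ?_⟩
    have e0 := congrFun hv 0
    have e1 := congrFun hv 1
    have e2 := congrFun hv 2
    have e3 := congrFun hv 3
    simp [twoForm, minkowski, Fin.sum_univ_four, Matrix.mulVec, dotProduct] at e0 e1 e2 e3 hv'
    -- The equations `F v = 0` say `v × y = v₀ x` besides `x · v = 0`. Since `|v|² = v₀²` and `|x| =
    -- |y|`, Lagrange's identity `|v × y|² + (y · v)² = |v|² |y|²` leaves no room for `y · v`.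
    have hyv : y₁ * v 1 + y₂ * v 2 + y₃ * v 3 = 0 := by
      rw [← sq_eq_zero_iff]
      linear_combination (y₁ ^ 2 + y₂ ^ 2 + y₃ ^ 2) * hv' - v 0 ^ 2 * h
        - (y₃ * v 2 - y₂ * v 3 + x₁ * v 0) * e1 - (y₁ * v 3 - y₃ * v 1 + x₂ * v 0) * e2
        - (y₂ * v 1 - y₁ * v 2 + x₃ * v 0) * e3
    -- With `y · v = 0` the double product `y × (v × y)` equals `r² v`, and it is also `v₀ (y × x) =
    -- -v₀ r z`.
    ext a
    fin_cases a <;> simp <;> field_simp <;> refine mul_left_cancel₀ hr ?_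
    · linear_combination v 1 * hy2 + v 0 * hz₁ + y₁ * hyv - y₃ * e2 + y₂ * e3
    · linear_combination v 2 * hy2 + v 0 * hz₂ + y₂ * hyv - y₁ * e3 + y₃ * e1
    · linear_combination v 3 * hy2 + v 0 * hz₃ + y₃ * hyv - y₂ * e1 + y₁ * e2

theorem IsNullDirection.smul_dual {g gi F D : Matrix (Fin 4) (Fin 4) ℝ} {l : Fin 4 → ℝ}
    (h : IsNullDirection g gi F D l) (c : ℝ) : IsNullDirection g gi F (c • D) l where
  ne_zero := h.ne_zero
  energy := h.energy
  mulVec_eq_zero := h.mulVec_eq_zero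
  dual_mulVec_eq_zero := by rw [smul_mulVec, h.dual_mulVec_eq_zero, smul_zero]
  null := h.null
  energy_dual := by
    rw [transpose_smul, Matrix.mul_smul, Matrix.smul_mul, Matrix.smul_mul, ← smul_add,
      h.energy_dual, smul_zero]
  exists_smul := h.exists_smul

/-- Change of frame for null directions: `B` is the frame and `C` the coframe. -/
theorem IsNullDirection.of_frame {g gi F D B C : Matrix (Fin 4) (Fin 4) ℝ} {l : Fin 4 → ℝ}
    (hBC : B * C = 1)
    (h : IsNullDirection (Bᵀ * g * B) (C * gi * Cᵀ) (Bᵀ * F * B) (Bᵀ * D * B) l) :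
    IsNullDirection g gi F D (B *ᵥ l) := by
  have hCB : C * B = 1 := mul_eq_one_comm.mp hBC
  have hBCt : Cᵀ * Bᵀ = 1 := by rw [← transpose_mul, hBC, transpose_one]
  have key : ∀ X Y : Matrix (Fin 4) (Fin 4) ℝ, Bᵀ * X * B * (C * gi * Cᵀ) * (Bᵀ * Y * B)ᵀ
      = Bᵀ * (X * gi * Yᵀ) * B := by
    intro X Y
    simp only [transpose_mul, transpose_transpose, Matrix.mul_assoc]
    rw [← Matrix.mul_assoc B C, hBC, Matrix.one_mul, ← Matrix.mul_assoc Cᵀ Bᵀ, hBCt, Matrix.one_mul]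
  have cancel : ∀ X Y : Matrix (Fin 4) (Fin 4) ℝ, Bᵀ * X * B = Bᵀ * Y * B → X = Y := by
    intro X Y hXY
    have := congrArg (fun Z => Cᵀ * Z * C) hXY
    simp only [Matrix.mul_assoc, hBC, Matrix.mul_one] at this
    simpa only [← Matrix.mul_assoc, hBCt, Matrix.one_mul] using this
  have cancelV : ∀ u v : Fin 4 → ℝ, Bᵀ *ᵥ u = Bᵀ *ᵥ v → u = v := by
    intro u v huv
    have := congrArg (fun Z => Cᵀ *ᵥ Z) huv
    simpa only [mulVec_mulVec, hBCt, one_mulVec] using this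
  refine ⟨?_, ?_, ?_, ?_, ?_, ?_, ?_⟩
  · intro h0
    apply h.ne_zero
    have := congrArg (fun Z => C *ᵥ Z) h0
    simpa only [mulVec_mulVec, hCB, one_mulVec, mulVec_zero] using this
  · apply cancel
    have := h.energy
    rw [key] at this
    rw [this, Matrix.mul_vecMulVec, Matrix.vecMulVec_mul, ← mulVec_transpose B]
    simp only [mulVec_mulVec, Matrix.mul_assoc]
  · apply cancelV
    simpa only [mulVec_mulVec, Matrix.mul_assoc, mulVec_zero] using h.mulVec_eq_zero
  · apply cancelV
    simpa only [mulVec_mulVec, Matrix.mul_assoc, mulVec_zero] using h.dual_mulVec_eq_zero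
  · have := h.null
    rw [Matrix.mul_assoc, ← mulVec_mulVec, dotProduct_mulVec, vecMul_transpose] at this
    simpa only [mulVec_mulVec] using this
  · apply cancel
    have := h.energy_dual
    rw [key, key, ← Matrix.add_mul, ← Matrix.mul_add] at this
    rw [this, Matrix.mul_zero, Matrix.zero_mul]
  · intro v hv hv'
    have hBv : B *ᵥ (C *ᵥ v) = v := by rw [mulVec_mulVec, hBC, one_mulVec]
    obtain ⟨c, hc⟩ := h.exists_smul (C *ᵥ v)
      (by simp only [← mulVec_mulVec]; rw [hBv, hv, mulVec_zero])
      (by simp only [← mulVec_mulVec]; rw [hBv, dotProduct_mulVec, vecMul_transpose, hBv, hv'])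
    exact ⟨c, by rw [← hBv, hc, mulVec_smul]⟩

theorem hodge_eq_epsDual (G : E4 → Matrix (Fin 4) (Fin 4) ℝ) (s : ℝ) (y : E4)
    (F : Fin 4 → Fin 4 → ℝ) :
    Matrix.of (hodge G s y F) =
      (s * √(-(G y).det)) • epsDual ((G y)⁻¹ * Matrix.of F * (G y)⁻¹ᵀ) := by
  ext a b
  simp only [hodge, volumeForm, epsDual, Matrix.of_apply, Matrix.smul_apply, smul_eq_mul,
    Matrix.mul_apply, Matrix.transpose_apply, Finset.mul_sum, Finset.sum_mul]
  refine Finset.sum_congr rfl fun c _ => Finset.sum_congr rfl fun d _ => ?_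
  rw [Finset.sum_comm]
  exact Finset.sum_congr rfl fun p _ => Finset.sum_congr rfl fun q _ => by ring

/-- The pairing `F_{ab} H^{ab}` of two-forms. -/
def pairing (gi F H : Matrix (Fin 4) (Fin 4) ℝ) : ℝ := (Fᵀ * (gi * H * giᵀ)).trace

theorem pairing_eq_sum (gi F H : Matrix (Fin 4) (Fin 4) ℝ) :
    pairing gi F H = ∑ a, ∑ b, ∑ c, ∑ d, gi a c * gi b d * F a b * H c d := by
  simp only [pairing, Matrix.trace, Matrix.diag, Matrix.mul_apply, Matrix.transpose_apply,
    Finset.mul_sum, Finset.sum_mul]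
  rw [Finset.sum_comm]
  refine Finset.sum_congr rfl fun a _ => Finset.sum_congr rfl fun b _ => ?_
  rw [Finset.sum_comm]
  exact Finset.sum_congr rfl fun p _ => Finset.sum_congr rfl fun q _ => by ring

theorem formSq_add_I_mul (G : E4 → Matrix (Fin 4) (Fin 4) ℝ) (y : E4)
    (F D : Fin 4 → Fin 4 → ℝ) :
    formSq G y (fun a b => (F a b : ℂ) + Complex.I * (D a b : ℂ)) =
      ((pairing (G y)⁻¹ (of F) (of F) - pairing (G y)⁻¹ (of D) (of D) : ℝ) : ℂ) +
      Complex.I * ((pairing (G y)⁻¹ (of F) (of D) + pairing (G y)⁻¹ (of D) (of F) : ℝ) : ℂ) := by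
  simp only [formSq, pairing_eq_sum, Matrix.of_apply]
  push_cast
  simp only [mul_add, Finset.mul_sum, ← Finset.sum_sub_distrib, ← Finset.sum_add_distrib]
  refine Finset.sum_congr rfl fun a _ => Finset.sum_congr rfl fun b _ =>
    Finset.sum_congr rfl fun c _ => Finset.sum_congr rfl fun d _ => ?_
  linear_combination (((G y)⁻¹ a c : ℂ) * ((G y)⁻¹ b d : ℂ) * D a b * D c d) * Complex.I_sq

theorem pairing_frame {gi F H B C : Matrix (Fin 4) (Fin 4) ℝ} (hBC : B * C = 1) :
    pairing gi F H = pairing (C * gi * Cᵀ) (Bᵀ * F * B) (Bᵀ * H * B) := by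
  have hBCt : Cᵀ * Bᵀ = 1 := by rw [← transpose_mul, hBC, transpose_one]
  have : (Bᵀ * F * B)ᵀ * ((C * gi * Cᵀ) * (Bᵀ * H * B) * (C * gi * Cᵀ)ᵀ)
      = Bᵀ * (Fᵀ * (gi * H * giᵀ) * Cᵀ) := by
    simp only [transpose_mul, transpose_transpose, Matrix.mul_assoc]
    congr 2
    rw [← Matrix.mul_assoc B C, hBC, Matrix.one_mul, ← Matrix.mul_assoc Cᵀ Bᵀ, hBCt, Matrix.one_mul,
      ← Matrix.mul_assoc B C, hBC, Matrix.one_mul]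
  rw [pairing, pairing, this, Matrix.trace_mul_comm Bᵀ, Matrix.mul_assoc _ Cᵀ, hBCt, Matrix.mul_one]

theorem pairing_smul_smul (gi F H : Matrix (Fin 4) (Fin 4) ℝ) (b c : ℝ) :
    pairing gi (b • F) (c • H) = b * c * pairing gi F H := by
  simp only [pairing, transpose_smul, Matrix.smul_mul, Matrix.mul_smul, trace_smul, smul_eq_mul]
  ring

theorem pairing_minkowski_twoForm (x₁ x₂ x₃ y₁ y₂ y₃ u₁ u₂ u₃ v₁ v₂ v₃ : ℝ) :
    pairing minkowski (twoForm x₁ x₂ x₃ y₁ y₂ y₃) (twoForm u₁ u₂ u₃ v₁ v₂ v₃) =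
      2 * (y₁ * v₁ + y₂ * v₂ + y₃ * v₃ - (x₁ * u₁ + x₂ * u₂ + x₃ * u₃)) := by
  simp only [pairing, Matrix.trace, Matrix.diag, Matrix.mul_apply, Matrix.transpose_apply,
    Fin.sum_univ_four, minkowski, twoForm, Matrix.of_apply, Matrix.cons_val]
  ring

theorem minkowski_mul_self : minkowski * minkowski = 1 := by
  ext a b
  fin_cases a <;> fin_cases b <;> simp [minkowski]

theorem transpose_minkowski : minkowskiᵀ = minkowski := by
  ext a b
  fin_cases a <;> fin_cases b <;> simp [minkowski]

theorem det_minkowski : minkowski.det = -1 := by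
  simp [det_four, minkowski]

/-- In an orthonormal frame the real and imaginary parts of `ℱ² = 0` say that the electric and
magnetic parts have equal length and are orthogonal. The common length is non-zero since otherwise
`F` and `F⋆` would both vanish. -/
theorem exists_isNullDirection {G : E4 → Matrix (Fin 4) (Fin 4) ℝ} {y : E4} {s : ℝ}
    (hs : s = 1 ∨ s = -1) {B : Matrix (Fin 4) (Fin 4) ℝ} (hB : Bᵀ * G y * B = minkowski)
    {F : Fin 4 → Fin 4 → ℝ} (hF : ∀ a b, F a b + F b a = 0)
    (hnull : formSq G y (fun a b => (F a b : ℂ) + Complex.I * (hodge G s y F a b : ℂ)) = 0)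
    (hne : (fun a b => (F a b : ℂ) + Complex.I * (hodge G s y F a b : ℂ)) ≠ 0) :
    ∃ l, IsNullDirection (G y) (G y)⁻¹ (of F) (of (hodge G s y F)) l := by
  have hdet : B.det * B.det * (G y).det = -1 := by
    have := congrArg Matrix.det hB
    rw [det_mul, det_mul, det_transpose, det_minkowski] at this
    linarith
  have hBdet : IsUnit B.det := by
    rw [isUnit_iff_ne_zero]; rintro h0; simp [h0] at hdet
  have hGdet : IsUnit (G y).det := by
    rw [isUnit_iff_ne_zero]; rintro h0; simp [h0] at hdet
  have hBC : B * B⁻¹ = 1 := mul_nonsing_inv _ hBdet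
  have hCB : B⁻¹ * B = 1 := nonsing_inv_mul _ hBdet
  have hBCt : Bᵀ * B⁻¹ᵀ = 1 := by rw [← transpose_mul, hCB, transpose_one]
  have hBCt' : B⁻¹ᵀ * Bᵀ = 1 := by rw [← transpose_mul, hBC, transpose_one]
  have hgiC : B⁻¹ * (G y)⁻¹ * B⁻¹ᵀ = minkowski := by
    have := congrArg (fun Z : Matrix (Fin 4) (Fin 4) ℝ => Z⁻¹) hB
    rw [Matrix.mul_inv_rev, Matrix.mul_inv_rev, ← transpose_nonsing_inv,
      Matrix.inv_eq_right_inv minkowski_mul_self] at this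
    rw [Matrix.mul_assoc, this]
  have hginv : (G y)⁻¹ = B * minkowski * Bᵀ := by
    rw [← hgiC]
    simp only [Matrix.mul_assoc]
    rw [hBCt', Matrix.mul_one, ← Matrix.mul_assoc, hBC, Matrix.one_mul]
  obtain ⟨x₁, x₂, x₃, y₁, y₂, y₃, hFhat⟩ : ∃ x₁ x₂ x₃ y₁ y₂ y₃,
      Bᵀ * of F * B = twoForm x₁ x₂ x₃ y₁ y₂ y₃ := by
    refine ⟨_, _, _, _, _, _, eq_twoForm_of_antisymm ?_⟩
    have : (of F)ᵀ = - of F := by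
      ext a b
      simp only [transpose_apply, of_apply, Matrix.neg_apply]
      linarith [hF a b]
    simp only [transpose_mul, transpose_transpose, this, Matrix.mul_assoc, Matrix.mul_neg,
      Matrix.neg_mul]
  obtain ⟨σ, hσ, hDhat⟩ : ∃ σ : ℝ, σ * σ = 1 ∧
      Bᵀ * of (hodge G s y F) * B = σ • twoForm y₁ y₂ y₃ (-x₁) (-x₂) (-x₃) := by
    -- The frame need not be positively oriented: `σ` is the orientation sign of the coordinates
    -- times that of the frame, and `(det B)² det G = -1` makes its square `1`.
    refine ⟨s * √(-(G y).det) * B.det, ?_, ?_⟩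
    · have h1 : 0 ≤ -(G y).det := by
        by_contra! hc
        nlinarith [mul_self_nonneg B.det]
      have h2 : √(-(G y).det) * √(-(G y).det) = -(G y).det := Real.mul_self_sqrt h1
      have h3 : s * s = 1 := by rcases hs with rfl | rfl <;> norm_num
      linear_combination (√(-(G y).det) * √(-(G y).det) * B.det * B.det) * h3
        + B.det * B.det * h2 - hdet
    · rw [← epsDual_minkowski_twoForm, ← hFhat, mul_smul, ← transpose_mul_epsDual_mul,
        hodge_eq_epsDual, Matrix.mul_smul, Matrix.smul_mul]
      congr 4
      rw [hginv]
      simp only [transpose_mul, transpose_transpose, Matrix.mul_assoc, transpose_minkowski]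
  have hnull' := hnull
  rw [formSq_add_I_mul, Complex.ext_iff] at hnull'
  simp only [Complex.add_re, Complex.add_im, Complex.ofReal_re, Complex.ofReal_im, Complex.mul_re,
    Complex.mul_im, Complex.I_re, Complex.I_im, Complex.zero_re, Complex.zero_im] at hnull'
  rw [pairing_frame (F := of F) (H := of F) hBC, pairing_frame (F := of F) (H := of (hodge _ _ _ _)) hBC,
    pairing_frame (F := of (hodge _ _ _ _)) (H := of F) hBC,
    pairing_frame (F := of (hodge _ _ _ _)) (H := of (hodge _ _ _ _)) hBC,
    hFhat, hDhat, hgiC] at hnull'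
  have e1 := pairing_smul_smul minkowski (twoForm x₁ x₂ x₃ y₁ y₂ y₃)
    (twoForm y₁ y₂ y₃ (-x₁) (-x₂) (-x₃)) 1 σ
  have e2 := pairing_smul_smul minkowski (twoForm y₁ y₂ y₃ (-x₁) (-x₂) (-x₃))
    (twoForm x₁ x₂ x₃ y₁ y₂ y₃) σ 1
  rw [one_smul] at e1 e2
  rw [pairing_smul_smul, e1, e2] at hnull'
  simp only [pairing_minkowski_twoForm] at hnull'
  obtain ⟨n1, n2⟩ := hnull'
  have h : x₁ ^ 2 + x₂ ^ 2 + x₃ ^ 2 = y₁ ^ 2 + y₂ ^ 2 + y₃ ^ 2 := by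
    rw [hσ] at n1; linarith
  have h' : x₁ * y₁ + x₂ * y₂ + x₃ * y₃ = 0 := by
    have : σ ≠ 0 := by rintro rfl; simp at hσ
    apply mul_left_cancel₀ this
    linarith
  have hx : x₁ ^ 2 + x₂ ^ 2 + x₃ ^ 2 ≠ 0 := by
    intro h0
    have hy0 := h.symm.trans h0
    have a1 : x₁ = 0 := (pow_eq_zero_iff two_ne_zero).mp (by linarith [sq_nonneg x₁, sq_nonneg x₂, sq_nonneg x₃])
    have a2 : x₂ = 0 := (pow_eq_zero_iff two_ne_zero).mp (by linarith [sq_nonneg x₁, sq_nonneg x₂, sq_nonneg x₃])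
    have a3 : x₃ = 0 := (pow_eq_zero_iff two_ne_zero).mp (by linarith [sq_nonneg x₁, sq_nonneg x₂, sq_nonneg x₃])
    have b1 : y₁ = 0 := (pow_eq_zero_iff two_ne_zero).mp (by linarith [sq_nonneg y₁, sq_nonneg y₂, sq_nonneg y₃])
    have b2 : y₂ = 0 := (pow_eq_zero_iff two_ne_zero).mp (by linarith [sq_nonneg y₁, sq_nonneg y₂, sq_nonneg y₃])
    have b3 : y₃ = 0 := (pow_eq_zero_iff two_ne_zero).mp (by linarith [sq_nonneg y₁, sq_nonneg y₂, sq_nonneg y₃])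
    have z : twoForm 0 0 0 0 0 0 = 0 := by
      ext a b; fin_cases a <;> fin_cases b <;> simp [twoForm]
    have cancel : ∀ X : Matrix (Fin 4) (Fin 4) ℝ, Bᵀ * X * B = 0 → X = 0 := by
      intro X hX
      have := congrArg (fun Z => B⁻¹ᵀ * Z * B⁻¹) hX
      simp only [Matrix.mul_assoc, hBC, Matrix.mul_one, Matrix.zero_mul, Matrix.mul_zero] at this
      simpa only [← Matrix.mul_assoc, hBCt', Matrix.one_mul] using this
    rw [a1, a2, a3, b1, b2, b3] at hFhat hDhat
    rw [neg_zero, z, smul_zero] at hDhat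
    rw [z] at hFhat
    apply hne
    ext a b
    have c1 : F a b = 0 := congrFun₂ (cancel _ hFhat) a b
    have c2 : hodge G s y F a b = 0 := congrFun₂ (cancel _ hDhat) a b
    simp [c1, c2]
  obtain ⟨l, hl⟩ := exists_isNullDirection_twoForm h h' hx
  refine ⟨B *ᵥ l, IsNullDirection.of_frame hBC ?_⟩
  rw [hB, hgiC, hFhat, hDhat]
  exact hl.smul_dual σ

/-! ### Partial derivatives -/

section PartialDerivatives

variable {f g : E4 → ℝ} {y : E4} {V : Set E4}

theorem pd_mul (a : Fin 4) (hf : DifferentiableAt ℝ f y) (hg : DifferentiableAt ℝ g y) :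
    pd a (fun z => f z * g z) y = pd a f y * g y + f y * pd a g y := by
  simp only [pd, fderiv_fun_mul hf hg, _root_.add_apply, _root_.smul_apply, smul_eq_mul]
  ring

theorem pd_sub (a : Fin 4) (hf : DifferentiableAt ℝ f y) (hg : DifferentiableAt ℝ g y) :
    pd a (fun z => f z - g z) y = pd a f y - pd a g y := by
  simp only [pd, fderiv_fun_sub hf hg, _root_.sub_apply]

theorem pd_neg (a : Fin 4) : pd a (fun z => -f z) y = -pd a f y := by
  simp only [pd, fderiv_fun_neg, _root_.neg_apply]

theorem pd_sum {ι : Type*} (s : Finset ι) (a : Fin 4) {f : ι → E4 → ℝ}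
    (hf : ∀ i ∈ s, DifferentiableAt ℝ (f i) y) :
    pd a (fun z => ∑ i ∈ s, f i z) y = ∑ i ∈ s, pd a (f i) y := by
  simp only [pd, fderiv_fun_sum hf, _root_.sum_apply]

theorem pd_const (a : Fin 4) (c : ℝ) : pd a (fun _ => c) y = 0 := by
  simp [pd]

theorem pd_congr (hV : IsOpen V) (hy : y ∈ V) (h : ∀ z ∈ V, f z = g z) (a : Fin 4) :
    pd a f y = pd a g y := by
  have : f =ᶠ[nhds y] g := Filter.eventuallyEq_of_mem (hV.mem_nhds hy) h
  rw [pd, pd, this.fderiv_eq]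

theorem differentiableAt_of_contDiffOn {n : WithTop ℕ∞} (hf : ContDiffOn ℝ n f V)
    (hn : n ≠ 0) (hV : IsOpen V) (hy : y ∈ V) : DifferentiableAt ℝ f y :=
  (hf.differentiableOn hn).differentiableAt (hV.mem_nhds hy)

theorem contDiffOn_pd {m n : WithTop ℕ∞} (hf : ContDiffOn ℝ n f V) (hmn : m + 1 ≤ n)
    (hV : IsOpen V) (a : Fin 4) : ContDiffOn ℝ m (pd a f) V :=
  (hf.fderiv_of_isOpen hV hmn).clm_apply contDiffOn_const

theorem pd_comm (hf : ContDiffOn ℝ 2 f V) (hV : IsOpen V) (hy : y ∈ V) (a b : Fin 4) :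
    pd a (pd b f) y = pd b (pd a f) y := by
  have hd : DifferentiableAt ℝ (fderiv ℝ f) y :=
    ((hf.fderiv_of_isOpen hV (m := 1) (by norm_num)).differentiableOn one_ne_zero).differentiableAt
      (hV.mem_nhds hy)
  have hs : IsSymmSndFDerivAt ℝ f y :=
    (hf.contDiffAt (hV.mem_nhds hy)).isSymmSndFDerivAt (by simp)
  have key : ∀ v w : E4, fderiv ℝ (fun z => fderiv ℝ f z v) y w = fderiv ℝ (fderiv ℝ f) y w v := by
    intro v w
    rw [fderiv_clm_apply hd (differentiableAt_const v)]
    simp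
  change fderiv ℝ (fun z => fderiv ℝ f z _) y _ = fderiv ℝ (fun z => fderiv ℝ f z _) y _
  rw [key, key]
  exact hs _ _

theorem fderiv_eq_sum_pd (f : E4 → ℝ) (y v : E4) : fderiv ℝ f y v = ∑ a, v a * pd a f y := by
  have hv : v = ∑ a, v a • (EuclideanSpace.single a (1 : ℝ) : E4) := by
    ext i
    simp [Pi.single_apply]
  conv_lhs => rw [hv]
  simp [map_sum, pd]

/-- This raises regularity in a first-order system that expresses all partial derivatives through
the unknowns. -/
theorem contDiffOn_succ_of_pd {n : ℕ} (hV : IsOpen V) (hf : DifferentiableOn ℝ f V)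
    (h : ∀ a, ContDiffOn ℝ n (pd a f) V) : ContDiffOn ℝ (n + 1 : ℕ) f V := by
  push_cast
  rw [contDiffOn_succ_iff_fderiv_of_isOpen hV]
  refine ⟨hf, by simp, ?_⟩
  have : fderiv ℝ f = fun y => ∑ a, pd a f y • (EuclideanSpace.proj a : E4 →L[ℝ] ℝ) := by
    ext y v
    rw [fderiv_eq_sum_pd]
    simp [mul_comm]
  rw [this]
  exact ContDiffOn.sum fun a _ => (h a).smul contDiffOn_const

/-- The entrywise partial derivative of a matrix valued function. -/
def pdMatrix (e : Fin 4) (A : E4 → Matrix (Fin 4) (Fin 4) ℝ) (y : E4) :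
    Matrix (Fin 4) (Fin 4) ℝ :=
  of fun a b => pd e (fun z => A z a b) y

theorem pdMatrix_mul (e : Fin 4) {A B : E4 → Matrix (Fin 4) (Fin 4) ℝ}
    (hA : ∀ a b, DifferentiableAt ℝ (fun z => A z a b) y)
    (hB : ∀ a b, DifferentiableAt ℝ (fun z => B z a b) y) :
    pdMatrix e (fun z => A z * B z) y = pdMatrix e A y * B y + A y * pdMatrix e B y := by
  ext a b
  simp only [pdMatrix, Matrix.mul_apply, Matrix.of_apply, Matrix.add_apply]
  rw [pd_sum _ _ fun c _ => (hA a c).fun_mul (hB c b), ← Finset.sum_add_distrib]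
  exact Finset.sum_congr rfl fun c _ => pd_mul e (hA a c) (hB c b)

theorem pdMatrix_transpose (e : Fin 4) (A : E4 → Matrix (Fin 4) (Fin 4) ℝ) :
    pdMatrix e (fun z => (A z)ᵀ) y = (pdMatrix e A y)ᵀ := rfl

end PartialDerivatives

/-! ### Levi-Civita calculus -/

/-- `G` is a nondegenerate `C^3` metric on the open set `V`. -/
structure IsMetricOn (G : E4 → Matrix (Fin 4) (Fin 4) ℝ) (V : Set E4) : Prop where
  isOpen : IsOpen V
  contDiffOn : ∀ a b, ContDiffOn ℝ 3 (fun z => G z a b) V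
  symm : ∀ y ∈ V, ∀ a b, G y a b = G y b a
  isUnit_det : ∀ y ∈ V, IsUnit (G y).det

theorem IsMetricOn.mono {G : E4 → Matrix (Fin 4) (Fin 4) ℝ} {V W : Set E4} (h : IsMetricOn G V)
    (hW : IsOpen W) (hWV : W ⊆ V) : IsMetricOn G W where
  isOpen := hW
  contDiffOn a b := (h.contDiffOn a b).mono hWV
  symm y hy := h.symm y (hWV hy)
  isUnit_det y hy := h.isUnit_det y (hWV hy)

section Metric

variable {G : E4 → Matrix (Fin 4) (Fin 4) ℝ} {V : Set E4} {y : E4}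

namespace IsMetricOn

theorem transpose_eq (hG : IsMetricOn G V) (hy : y ∈ V) : (G y)ᵀ = G y := by
  ext a b
  exact hG.symm y hy b a

theorem inv_mul (hG : IsMetricOn G V) (hy : y ∈ V) : (G y)⁻¹ * G y = 1 :=
  nonsing_inv_mul _ (hG.isUnit_det y hy)

theorem mul_inv (hG : IsMetricOn G V) (hy : y ∈ V) : G y * (G y)⁻¹ = 1 :=
  mul_nonsing_inv _ (hG.isUnit_det y hy)

theorem contDiffOn_det {A : E4 → Matrix (Fin 4) (Fin 4) ℝ} {n : WithTop ℕ∞}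
    (hA : ∀ a b, ContDiffOn ℝ n (fun z => A z a b) V) :
    ContDiffOn ℝ n (fun z => (A z).det) V := by
  simp only [Matrix.det_apply]
  exact ContDiffOn.sum fun σ _ => (contDiffOn_prod fun i _ => hA _ _).const_smul _

theorem contDiffOn_inv (hG : IsMetricOn G V) (a b : Fin 4) :
    ContDiffOn ℝ 3 (fun z => (G z)⁻¹ a b) V := by
  simp only [Matrix.inv_def, Matrix.smul_apply, smul_eq_mul, Ring.inverse_eq_inv']
  refine ContDiffOn.mul ((contDiffOn_det hG.contDiffOn).inv fun y hy => (hG.isUnit_det y hy).ne_zero)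
    ?_
  simp only [Matrix.adjugate_apply]
  refine contDiffOn_det fun c d => ?_
  by_cases hc : c = b
  · subst hc
    simp only [Matrix.updateRow_self]
    exact contDiffOn_const
  · simp only [Matrix.updateRow_ne hc]
    exact hG.contDiffOn c d

theorem contDiffOn_christoffel (hG : IsMetricOn G V) (a b c : Fin 4) :
    ContDiffOn ℝ 2 (fun z => christoffel G z a b c) V := by
  have h : ∀ a b c, ContDiffOn ℝ 2 (pd a fun z => G z b c) V := fun a b c =>
    contDiffOn_pd (hG.contDiffOn b c) (by norm_num) hG.isOpen a
  unfold christoffel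
  exact contDiffOn_const.mul (ContDiffOn.sum fun d _ =>
    ((hG.contDiffOn_inv a d).of_le (by norm_num)).mul (((h _ _ _).add (h _ _ _)).sub (h _ _ _)))

theorem christoffel_symm (hG : IsMetricOn G V) (hy : y ∈ V) (a b c : Fin 4) :
    christoffel G y a b c = christoffel G y a c b := by
  unfold christoffel
  congr 1
  refine Finset.sum_congr rfl fun d _ => ?_
  rw [pd_congr hG.isOpen hy (fun z hz => hG.symm z hz b c) d]
  ring

/-- The matrix `(Γ_e)^a_b`. -/
def christoffelMatrix (G : E4 → Matrix (Fin 4) (Fin 4) ℝ) (y : E4) (e : Fin 4) :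
    Matrix (Fin 4) (Fin 4) ℝ :=
  of fun a b => christoffel G y a e b

theorem mul_christoffelMatrix (hG : IsMetricOn G V) (hy : y ∈ V) (e f c : Fin 4) :
    (G y * christoffelMatrix G y e) f c = (1 / 2) *
      (pd e (fun z => G z f c) y + pd c (fun z => G z f e) y - pd f (fun z => G z e c) y) := by
  have h : christoffelMatrix G y e = (1 / 2 : ℝ) • ((G y)⁻¹ * of fun d c =>
      (pd e (fun z => G z d c) y + pd c (fun z => G z d e) y - pd d (fun z => G z e c) y)) := by
    ext a b
    simp [christoffelMatrix, christoffel, Matrix.mul_apply]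
  rw [h, Matrix.mul_smul, ← Matrix.mul_assoc, hG.mul_inv hy, Matrix.one_mul]
  rfl

/-- This is `∇g = 0` in matrix form. -/
theorem pdMatrix_metric (hG : IsMetricOn G V) (hy : y ∈ V) (e : Fin 4) :
    pdMatrix e G y = (christoffelMatrix G y e)ᵀ * G y + G y * christoffelMatrix G y e := by
  have h : (christoffelMatrix G y e)ᵀ * G y = (G y * christoffelMatrix G y e)ᵀ := by
    rw [transpose_mul, hG.transpose_eq hy]
  ext a b
  rw [h, Matrix.add_apply, Matrix.transpose_apply, hG.mul_christoffelMatrix hy,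
    hG.mul_christoffelMatrix hy, pd_congr hG.isOpen hy (fun z hz => hG.symm z hz b a) e,
    pd_congr hG.isOpen hy (fun z hz => hG.symm z hz b e) a,
    pd_congr hG.isOpen hy (fun z hz => hG.symm z hz a e) b]
  simp only [pdMatrix, Matrix.of_apply]
  ring

theorem pdMatrix_inv (hG : IsMetricOn G V) (hy : y ∈ V) (e : Fin 4) :
    pdMatrix e (fun z => (G z)⁻¹) y =
      -(christoffelMatrix G y e * (G y)⁻¹ + (G y)⁻¹ * (christoffelMatrix G y e)ᵀ) := by
  have h0 : pdMatrix e (fun z => (G z)⁻¹ * G z) y = 0 := by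
    ext a b
    simp only [pdMatrix, Matrix.of_apply, Matrix.zero_apply]
    rw [pd_congr hG.isOpen hy (g := fun _ => (1 : Matrix (Fin 4) (Fin 4) ℝ) a b)
      (fun z hz => by rw [hG.inv_mul hz]), pd_const]
  rw [pdMatrix_mul e
    (fun a b => differentiableAt_of_contDiffOn (hG.contDiffOn_inv a b) (by norm_num) hG.isOpen hy)
    (fun a b => differentiableAt_of_contDiffOn (hG.contDiffOn a b) (by norm_num) hG.isOpen hy),
    hG.pdMatrix_metric hy] at h0
  have h1 := congrArg (fun Z => Z * (G y)⁻¹) h0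
  simp only [Matrix.add_mul, Matrix.mul_add, Matrix.mul_assoc, hG.mul_inv hy, Matrix.mul_one,
    Matrix.zero_mul] at h1
  rw [← Matrix.mul_assoc (G y)⁻¹ (G y), hG.inv_mul hy, Matrix.one_mul] at h1
  rw [eq_neg_of_add_eq_zero_left h1, add_comm]

end IsMetricOn

end Metric

/-! ### Covariant derivatives of forms, the Ricci identity and Killing fields -/

section Forms

variable {G : E4 → Matrix (Fin 4) (Fin 4) ℝ} {V : Set E4} {y : E4}

/-- `∇_a θ_b` for a one-form `θ`. -/
def covDerivForm (G : E4 → Matrix (Fin 4) (Fin 4) ℝ) (θ : E4 → Fin 4 → ℝ) (y : E4)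
    (a b : Fin 4) : ℝ :=
  pd a (fun z => θ z b) y - ∑ c, christoffel G y c a b * θ y c

/-- `∇_c H_{ab}` for a covariant two-tensor `H`. -/
def covDerivTwo (G : E4 → Matrix (Fin 4) (Fin 4) ℝ) (H : E4 → Fin 4 → Fin 4 → ℝ) (y : E4)
    (c a b : Fin 4) : ℝ :=
  pd c (fun z => H z a b) y - ∑ s, christoffel G y s c a * H y s b
    - ∑ s, christoffel G y s c b * H y a s

/-- The Riemann tensor `R^r_{bcd}`. -/
def riemannUp (G : E4 → Matrix (Fin 4) (Fin 4) ℝ) (y : E4) (r b c d : Fin 4) : ℝ :=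
  pd c (fun z => christoffel G z r d b) y - pd d (fun z => christoffel G z r c b) y
    + ∑ s, (christoffel G y r c s * christoffel G y s d b
      - christoffel G y r d s * christoffel G y s c b)

theorem riemann_eq (G : E4 → Matrix (Fin 4) (Fin 4) ℝ) (y : E4) (a b c d : Fin 4) :
    riemann G y a b c d = ∑ r, G y a r * riemannUp G y r b c d := rfl

namespace IsMetricOn

theorem riemannUp_bianchi (hG : IsMetricOn G V) (hy : y ∈ V) (r b c d : Fin 4) :
    riemannUp G y r b c d + riemannUp G y r c d b + riemannUp G y r d b c = 0 := by
  have h : ∀ a b c d, pd d (fun z => christoffel G z a b c) y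
      = pd d (fun z => christoffel G z a c b) y := fun a b c d =>
    pd_congr hG.isOpen hy (fun z hz => hG.christoffel_symm hz a b c) d
  simp only [riemannUp, Fin.sum_univ_four]
  rw [h r d b c, h r c b d, h r d c b]
  simp only [hG.christoffel_symm hy _ d b, hG.christoffel_symm hy _ c b,
    hG.christoffel_symm hy _ d c]
  ring

theorem riemann_bianchi (hG : IsMetricOn G V) (hy : y ∈ V) (a b c d : Fin 4) :
    riemann G y a b c d + riemann G y a c d b + riemann G y a d b c = 0 := by
  simp only [riemann_eq, ← Finset.sum_add_distrib, ← mul_add, hG.riemannUp_bianchi hy, mul_zero,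
    Finset.sum_const_zero]

theorem contDiffOn_covDerivForm (hG : IsMetricOn G V) {n : WithTop ℕ∞} (hn : n ≤ 2)
    {θ : E4 → Fin 4 → ℝ}
    (hθ : ∀ a, ContDiffOn ℝ (n + 1) (fun z => θ z a) V) (a b : Fin 4) :
    ContDiffOn ℝ n (fun z => covDerivForm G θ z a b) V := by
  unfold covDerivForm
  exact (contDiffOn_pd (hθ b) le_rfl hG.isOpen a).sub (ContDiffOn.sum fun c _ =>
    ((hG.contDiffOn_christoffel c a b).of_le hn).mul ((hθ c).of_le le_self_add))

/-- The Ricci identity for one-forms. -/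
theorem ricci_identity (hG : IsMetricOn G V) (hy : y ∈ V) {θ : E4 → Fin 4 → ℝ}
    (hθ : ∀ a, ContDiffOn ℝ 2 (fun z => θ z a) V) (c a b : Fin 4) :
    covDerivTwo G (covDerivForm G θ) y c a b - covDerivTwo G (covDerivForm G θ) y a c b
      = -∑ r, θ y r * riemannUp G y r b c a := by
  have hΓ : ∀ a b c, DifferentiableAt ℝ (fun z => christoffel G z a b c) y := fun a b c =>
    differentiableAt_of_contDiffOn (hG.contDiffOn_christoffel a b c) (by norm_num) hG.isOpen hy
  have hd : ∀ a, DifferentiableAt ℝ (fun z => θ z a) y := fun a =>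
    differentiableAt_of_contDiffOn (hθ a) (by norm_num) hG.isOpen hy
  have hdd : ∀ a b, DifferentiableAt ℝ (pd b fun z => θ z a) y := fun a b =>
    differentiableAt_of_contDiffOn (contDiffOn_pd (hθ a) (m := 1) (by norm_num) hG.isOpen b)
      (by norm_num) hG.isOpen hy
  have key : ∀ c a b, pd c (fun z => covDerivForm G θ z a b) y = pd c (pd a fun z => θ z b) y
      - ∑ r, (pd c (fun z => christoffel G z r a b) y * θ y r
        + christoffel G y r a b * pd c (fun z => θ z r) y) := by
    intro c a b
    unfold covDerivForm
    rw [pd_sub c (hdd b a) (DifferentiableAt.fun_sum fun r _ => (hΓ r a b).fun_mul (hd r)),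
      pd_sum _ _ fun r _ => (hΓ r a b).fun_mul (hd r)]
    congr 1
    exact Finset.sum_congr rfl fun r _ => pd_mul c (hΓ r a b) (hd r)
  simp only [covDerivTwo, key, pd_comm (hθ b) hG.isOpen hy c a]
  simp only [covDerivForm, riemannUp, hG.christoffel_symm hy _ c a, Fin.sum_univ_four]
  ring

theorem sum_lower_mul_riemannUp (hG : IsMetricOn G V) (hy : y ∈ V) (X : E4 → Fin 4 → ℝ)
    (b c d : Fin 4) :
    ∑ r, lower G X y r * riemannUp G y r b c d = ∑ r, X y r * riemann G y r b c d := by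
  simp only [lower, riemann_eq, Finset.mul_sum, Finset.sum_mul]
  rw [Finset.sum_comm]
  refine Finset.sum_congr rfl fun s _ => Finset.sum_congr rfl fun r _ => ?_
  rw [hG.symm y hy r s]
  ring

theorem contDiffOn_lower (hG : IsMetricOn G V) {X : E4 → Fin 4 → ℝ}
    (hX : ∀ a, ContDiffOn ℝ 3 (fun z => X z a) V) (a : Fin 4) :
    ContDiffOn ℝ 3 (fun z => lower G X z a) V := by
  unfold lower
  exact ContDiffOn.sum fun c _ => (hG.contDiffOn a c).mul (hX c)

/-- The second covariant derivative of a Killing field: `∇_c ∇_a ξ_b = R_{rcab} ξ^r`. -/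
theorem covDerivTwo_killing (hG : IsMetricOn G V) {X : E4 → Fin 4 → ℝ}
    (hX : ∀ a, ContDiffOn ℝ 3 (fun z => X z a) V)
    (hK : ∀ y ∈ V, ∀ a b, covDerivLower G X y a b + covDerivLower G X y b a = 0)
    (hy : y ∈ V) (c a b : Fin 4) :
    covDerivTwo G (covDerivLower G X) y c a b = ∑ r, X y r * riemann G y r c a b := by
  have hanti : ∀ c a b, covDerivTwo G (covDerivLower G X) y c a b
      = -covDerivTwo G (covDerivLower G X) y c b a := by
    intro c a b
    have h : ∀ z ∈ V, ∀ a b, covDerivLower G X z a b = -covDerivLower G X z b a := fun z hz a b =>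
      eq_neg_of_add_eq_zero_left (hK z hz a b)
    simp only [covDerivTwo]
    rw [pd_congr hG.isOpen hy (fun z hz => h z hz a b) c, pd_neg]
    simp only [h y hy a, h y hy _ b, mul_neg, Finset.sum_neg_distrib]
    ring
  have hric : ∀ c a b, covDerivTwo G (covDerivLower G X) y c a b
      - covDerivTwo G (covDerivLower G X) y a c b = -∑ r, X y r * riemann G y r b c a := by
    intro c a b
    rw [← hG.sum_lower_mul_riemannUp hy]
    exact hG.ricci_identity hy (fun a => (hG.contDiffOn_lower hX a).of_le (by norm_num)) c a b
  have hb : ∑ r, X y r * riemann G y r b c a + ∑ r, X y r * riemann G y r c a b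
      + ∑ r, X y r * riemann G y r a b c = 0 := by
    simp only [← Finset.sum_add_distrib, ← mul_add, hG.riemann_bianchi hy, mul_zero,
      Finset.sum_const_zero]
  -- Antisymmetry turns the three cyclic Ricci identities into equations for sums of two of `∇_c
  -- F_{ab}`, `∇_a F_{bc}`, `∇_b F_{ca}`. First plus third minus second isolates `2 ∇_c F_{ab}`, and
  -- the Bianchi identity merges the three curvature terms into one.
  linarith [hric c a b, hric a b c, hric b c a, hanti a c b, hanti b a c, hanti c b a]

/-- Lowering an index commutes with the covariant derivative. -/
theorem covDerivLower_eq_sum (hG : IsMetricOn G V) (hy : y ∈ V) {X : E4 → Fin 4 → ℝ}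
    (hX : ∀ a, DifferentiableAt ℝ (fun z => X z a) y) (a b : Fin 4) :
    covDerivLower G X y a b = ∑ c, G y b c * covDeriv G X y a c := by
  have hg : ∀ a b, DifferentiableAt ℝ (fun z => G z a b) y := fun a b =>
    differentiableAt_of_contDiffOn (hG.contDiffOn a b) (by norm_num) hG.isOpen hy
  have h1 : pd a (fun z => lower G X z b) y
      = ∑ c, (pd a (fun z => G z b c) y * X y c + G y b c * pd a (fun z => X z c) y) := by
    unfold lower
    rw [pd_sum _ _ fun r _ => (hg b r).fun_mul (hX r)]
    exact Finset.sum_congr rfl fun r _ => pd_mul a (hg b r) (hX r)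
  have h2 : ∀ c, pd a (fun z => G z b c) y = ∑ s, christoffel G y s a b * G y s c
      + ∑ s, G y b s * christoffel G y s a c := fun c => by
    simpa [pdMatrix, Matrix.mul_apply, christoffelMatrix] using
      congrFun₂ (hG.pdMatrix_metric hy a) b c
  simp only [covDerivLower, covDeriv, h1, h2]
  simp only [lower, Fin.sum_univ_four]
  ring

/-- The Leibniz rule for the contraction of a one-form with a vector field. -/
theorem pd_contraction {θ X : E4 → Fin 4 → ℝ}
    (hθ : ∀ a, DifferentiableAt ℝ (fun z => θ z a) y)
    (hX : ∀ a, DifferentiableAt ℝ (fun z => X z a) y) (a : Fin 4) :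
    pd a (fun z => ∑ b, θ z b * X z b) y =
      ∑ b, covDerivForm G θ y a b * X y b + ∑ b, θ y b * covDeriv G X y a b := by
  rw [pd_sum _ _ fun r _ => (hθ r).fun_mul (hX r),
    Finset.sum_congr rfl fun r _ => pd_mul a (hθ r) (hX r)]
  simp only [covDerivForm, covDeriv, Fin.sum_univ_four]
  ring

end IsMetricOn

end Forms

/-- A vacuum metric with a Killing field `X` whose self-dual Killing form is null, nowhere zero
and aligned with the self-dual Weyl tensor, on an open set of coordinates. -/
structure IsNullAligned (G : E4 → Matrix (Fin 4) (Fin 4) ℝ) (X : E4 → Fin 4 → ℝ) (s : E4 → ℝ)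
    (q : E4 → ℂ) (V : Set E4) : Prop where
  metric : IsMetricOn G V
  contDiffOn : ∀ a, ContDiffOn ℝ 3 (fun z => X z a) V
  killing : ∀ y ∈ V, ∀ a b, covDerivLower G X y a b + covDerivLower G X y b a = 0
  ricci : ∀ y ∈ V, ∀ a b, ricci G y a b = 0
  aligned : ∀ y ∈ V, ∀ a b c d, selfDualWeyl G (s y) y a b c d
    = q y * killingForm G (s y) X y a b * killingForm G (s y) X y c d
  direction : ∀ y ∈ V, ∃ l, IsNullDirection (G y) (G y)⁻¹ (of (covDerivLower G X y))
    (of (hodge G (s y) y (covDerivLower G X y))) l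

theorem epsilon_swap (a b c d : Fin 4) : epsilon a b c d = -epsilon b a c d := by
  have h := Matrix.det_permute (Equiv.swap (0 : Fin 4) 1)
    (Matrix.of fun i j : Fin 4 => if ![b, a, c, d] i = j then (1 : ℝ) else 0)
  rw [Equiv.Perm.sign_swap (by decide)] at h
  simp only [Units.val_neg, Units.val_one, Int.cast_neg, Int.cast_one, neg_mul, one_mul] at h
  rw [epsilon, epsilon, ← h]
  congr 1
  ext i j
  fin_cases i <;> rfl

theorem hodge_antisymm (G : E4 → Matrix (Fin 4) (Fin 4) ℝ) (s : ℝ) (y : E4)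
    (F : Fin 4 → Fin 4 → ℝ) (a b : Fin 4) : hodge G s y F a b = -hodge G s y F b a := by
  simp only [hodge, volumeForm, epsilon_swap a b, mul_neg, neg_mul, Finset.sum_neg_distrib]

/-! ### Recurrence of the Killing form and of its energy tensor -/

namespace IsNullAligned

variable {G : E4 → Matrix (Fin 4) (Fin 4) ℝ} {X : E4 → Fin 4 → ℝ} {s : E4 → ℝ} {q : E4 → ℂ}
  {V : Set E4} {y : E4}

theorem mono (h : IsNullAligned G X s q V) {W : Set E4} (hW : IsOpen W) (hWV : W ⊆ V) :
    IsNullAligned G X s q W where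
  metric := h.metric.mono hW hWV
  contDiffOn a := (h.contDiffOn a).mono hWV
  killing y hy := h.killing y (hWV hy)
  ricci y hy := h.ricci y (hWV hy)
  aligned y hy := h.aligned y (hWV hy)
  direction y hy := h.direction y (hWV hy)

/-- Ricci-flatness makes the Riemann and Weyl tensors coincide, and the Weyl tensor is the real part
of the self-dual one. -/
theorem riemann_eq_re (h : IsNullAligned G X s q V) (hy : y ∈ V) (a b c d : Fin 4) :
    riemann G y a b c d
      = (q y * killingForm G (s y) X y a b * killingForm G (s y) X y c d).re := by
  have h1 : weyl G y a b c d = riemann G y a b c d := by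
    simp [weyl, scalarCurv, h.ricci y hy]
  rw [← h.aligned y hy, ← h1, selfDualWeyl]
  simp

theorem sum_mul_riemann_eq (h : IsNullAligned G X s q V) (hy : y ∈ V) (Y : Fin 4 → ℝ)
    (c a b : Fin 4) :
    ∑ r, Y r * riemann G y r c a b =
      (q y * ∑ r, Y r * killingForm G (s y) X y r c).re * covDerivLower G X y a b
      - (q y * ∑ r, Y r * killingForm G (s y) X y r c).im *
        hodge G (s y) y (covDerivLower G X y) a b := by
  have : ∑ r, Y r * riemann G y r c a b = ((q y * ∑ r, Y r * killingForm G (s y) X y r c) *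
      killingForm G (s y) X y a b).re := by
    rw [Finset.mul_sum, Finset.sum_mul, Complex.re_sum]
    refine Finset.sum_congr rfl fun r _ => ?_
    rw [h.riemann_eq_re hy, ← Complex.re_ofReal_mul]
    congr 1
    ring
  rw [this, Complex.mul_re]
  simp [killingForm]

/-- With `α_c + iβ_c = q ξ^r ℱ_{rc}` this is the real part of the recurrence `∇_c ℱ_{ab} = (α_c +
iβ_c) ℱ_{ab}`. -/
theorem exists_covDerivTwo_eq (h : IsNullAligned G X s q V) (hy : y ∈ V) :
    ∃ α β : Fin 4 → ℝ, ∀ c a b, covDerivTwo G (covDerivLower G X) y c a b =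
      α c * covDerivLower G X y a b - β c * hodge G (s y) y (covDerivLower G X y) a b :=
  ⟨_, _, fun c a b => by
    rw [h.metric.covDerivTwo_killing h.contDiffOn h.killing hy, h.sum_mul_riemann_eq hy]⟩

/-- The tensor `T_{ab} = F_{ac} F_b^c` of the Killing form. -/
def energy (G : E4 → Matrix (Fin 4) (Fin 4) ℝ) (X : E4 → Fin 4 → ℝ) (y : E4) :
    Matrix (Fin 4) (Fin 4) ℝ :=
  of (covDerivLower G X y) * (G y)⁻¹ * (of (covDerivLower G X y))ᵀ

theorem contDiffOn_covDerivLower (h : IsNullAligned G X s q V) (a b : Fin 4) :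
    ContDiffOn ℝ 2 (fun z => covDerivLower G X z a b) V :=
  h.metric.contDiffOn_covDerivForm le_rfl
    (fun a => (h.metric.contDiffOn_lower h.contDiffOn a).of_le (by norm_num)) a b

theorem contDiffOn_energy (h : IsNullAligned G X s q V) (a b : Fin 4) :
    ContDiffOn ℝ 2 (fun z => energy G X z a b) V := by
  simp only [energy, Matrix.mul_apply, Matrix.transpose_apply, Matrix.of_apply]
  exact ContDiffOn.sum fun c _ => (ContDiffOn.sum fun d _ =>
    (h.contDiffOn_covDerivLower _ _).mul ((h.metric.contDiffOn_inv _ _).of_le (by norm_num))).mul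
      (h.contDiffOn_covDerivLower _ _)

/-- The recurrence `∇_e T = 2α_e T`, written with partial derivatives. Duality rotations of `ℱ` do
not change `T` to first order, so `β` drops out and a real recurrence remains. -/
theorem exists_pd_energy (h : IsNullAligned G X s q V) (hy : y ∈ V) :
    ∃ α : Fin 4 → ℝ, ∀ e a b, pd e (fun z => energy G X z a b) y =
      ∑ r, christoffel G y r e a * energy G X y r b + ∑ r, energy G X y a r * christoffel G y r e b
        + α e * energy G X y a b := by
  obtain ⟨α, β, hαβ⟩ := h.exists_covDerivTwo_eq hy
  obtain ⟨l, hl⟩ := h.direction y hy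
  refine ⟨fun e => 2 * α e, fun e a b => ?_⟩
  have hdF : ∀ a b, DifferentiableAt ℝ (fun z => of (covDerivLower G X z) a b) y := fun a b =>
    differentiableAt_of_contDiffOn (h.contDiffOn_covDerivLower a b) (by norm_num)
      h.metric.isOpen hy
  have hdG : ∀ a b, DifferentiableAt ℝ (fun z => (G z)⁻¹ a b) y := fun a b =>
    differentiableAt_of_contDiffOn (h.metric.contDiffOn_inv a b) (by norm_num)
      h.metric.isOpen hy
  have hdFG : ∀ a b, DifferentiableAt ℝ (fun z => (of (covDerivLower G X z) * (G z)⁻¹) a b) y := by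
    intro a b
    simp only [Matrix.mul_apply]
    exact DifferentiableAt.fun_sum fun c _ => (hdF a c).fun_mul (hdG c b)
  set F := of (covDerivLower G X y) with hF
  set D := of (hodge G (s y) y (covDerivLower G X y)) with hD
  set Γ := IsMetricOn.christoffelMatrix G y e with hΓ
  have hpdF : pdMatrix e (fun z => of (covDerivLower G X z)) y =
      Γᵀ * F + F * Γ + α e • F - β e • D := by
    ext a b
    have := hαβ e a b
    simp only [covDerivTwo] at this
    simp only [pdMatrix, Matrix.of_apply, Matrix.add_apply, Matrix.sub_apply, Matrix.smul_apply,
      Matrix.mul_apply, Matrix.transpose_apply, smul_eq_mul, hF, hD, hΓ,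
      IsMetricOn.christoffelMatrix]
    rw [Finset.sum_congr rfl fun x _ => mul_comm (covDerivLower G X y a x) _]
    linarith
  have hmat : pdMatrix e (energy G X) y =
      Γᵀ * energy G X y + energy G X y * Γ + (2 * α e) • energy G X y := by
    have h1 : pdMatrix e (energy G X) y = pdMatrix e (fun z => of (covDerivLower G X z) * (G z)⁻¹) y
        * Fᵀ + F * (G y)⁻¹ * (pdMatrix e (fun z => of (covDerivLower G X z)) y)ᵀ := by
      rw [← pdMatrix_transpose]
      exact pdMatrix_mul e hdFG fun a b => hdF b a
    rw [h1, pdMatrix_mul e hdF hdG, hpdF, h.metric.pdMatrix_inv hy, energy]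
    -- The derivative of the inverse metric cancels the Christoffel terms on the contracted indices.
    -- The `F⋆` part of `∇F` contributes `-β_e (F g⁻¹ F⋆ᵀ + F⋆ g⁻¹ Fᵀ)`, which is zero by
    -- `energy_dual`.
    have h2 := hl.energy_dual
    simp only [transpose_add, transpose_sub, transpose_smul, transpose_mul, transpose_transpose,
      Matrix.add_mul, Matrix.mul_add, Matrix.sub_mul, Matrix.mul_sub, Matrix.smul_mul,
      Matrix.mul_smul, Matrix.neg_mul, Matrix.mul_neg, Matrix.mul_assoc] at h2 ⊢
    have h3 := congrArg (fun Z => β e • Z) h2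
    simp only [smul_add, smul_zero] at h3
    rw [two_mul, add_smul, ← sub_eq_zero]
    rw [← neg_eq_zero, ← h3]
    abel
  simpa [pdMatrix, Matrix.mul_apply, hΓ, IsMetricOn.christoffelMatrix] using congrFun₂ hmat a b

end IsNullAligned

/-- A closed one-form with differentiable coefficients on a convex open set has a primitive. -/
theorem exists_pd_eq_of_closed {V : Set E4} (hV : IsOpen V) (hc : Convex ℝ V)
    {w : E4 → Fin 4 → ℝ} (hw : ∀ a, DifferentiableOn ℝ (fun z => w z a) V)
    (hcl : ∀ y ∈ V, ∀ a b, pd a (fun z => w z b) y = pd b (fun z => w z a) y) :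
    ∃ φ : E4 → ℝ, DifferentiableOn ℝ φ V ∧ ∀ y ∈ V, ∀ a, pd a φ y = w y a := by
  set W : E4 → E4 →L[ℝ] ℝ := fun z => ∑ a, w z a • (EuclideanSpace.proj a : E4 →L[ℝ] ℝ) with hW
  have hd : ∀ y ∈ V, ∀ a, HasFDerivAt (fun z => w z a) (fderiv ℝ (fun z => w z a) y) y :=
    fun y hy a => ((hw a).differentiableAt (hV.mem_nhds hy)).hasFDerivAt
  have hWd : ∀ y ∈ V, HasFDerivAt W (∑ a, (fderiv ℝ (fun z => w z a) y).smulRight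
      (EuclideanSpace.proj a : E4 →L[ℝ] ℝ)) y := fun y hy =>
    HasFDerivAt.fun_sum fun a _ =>
      (hd y hy a).smul_const (EuclideanSpace.proj a : E4 →L[ℝ] ℝ)
  obtain ⟨φ, hφ⟩ := hc.exists_forall_hasFDerivAt_of_fderiv_symmetric hV
    (fun y hy => (hWd y hy).differentiableAt.differentiableWithinAt) (fun y hy u v => by
      rw [(hWd y hy).fderiv]
      simp only [_root_.sum_apply, ContinuousLinearMap.smulRight_apply, _root_.smul_apply,
        PiLp.proj_apply, smul_eq_mul, fderiv_eq_sum_pd, Finset.sum_mul]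
      rw [Finset.sum_comm]
      refine Finset.sum_congr rfl fun a _ => Finset.sum_congr rfl fun b _ => ?_
      rw [hcl y hy a b]
      ring)
  refine ⟨φ, fun y hy => (hφ y hy).differentiableAt.differentiableWithinAt, fun y hy a => ?_⟩
  rw [pd, (hφ y hy).fderiv]
  simp [hW]

/-! ### From the recurrent null one-form to a parallel vector field -/

namespace IsNullAligned

variable {G : E4 → Matrix (Fin 4) (Fin 4) ℝ} {X : E4 → Fin 4 → ℝ} {s : E4 → ℝ} {q : E4 → ℂ}
  {V : Set E4} {y : E4} {n : Fin 4}

/-- The principal null one-form, normalized so that its `n`-th component is `1`. -/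
def nullForm (G : E4 → Matrix (Fin 4) (Fin 4) ℝ) (X : E4 → Fin 4 → ℝ) (n : Fin 4) (y : E4)
    (a : Fin 4) : ℝ :=
  energy G X y a n / energy G X y n n

theorem exists_vector_nullForm (h : IsNullAligned G X s q V) (hy : y ∈ V)
    (hn : energy G X y n n ≠ 0) :
    ∃ m : Fin 4 → ℝ, m ≠ 0 ∧ nullForm G X n y = G y *ᵥ m ∧
      of (covDerivLower G X y) *ᵥ m = 0 ∧
      of (hodge G (s y) y (covDerivLower G X y)) *ᵥ m = 0 ∧ m ⬝ᵥ G y *ᵥ m = 0 ∧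
      ∀ a b, energy G X y a b = nullForm G X n y a * nullForm G X n y b * energy G X y n n := by
  obtain ⟨l, hl⟩ := h.direction y hy
  have hE : ∀ a b, energy G X y a b = (G y *ᵥ l) a * (G y *ᵥ l) b := fun a b => by
    rw [energy, hl.energy, vecMulVec_apply]
  set μ := (G y *ᵥ l) n with hμ
  have hμ0 : μ ≠ 0 := by
    intro h0
    rw [hE, ← hμ, h0] at hn
    simp at hn
  have hf : nullForm G X n y = G y *ᵥ (μ⁻¹ • l) := by
    ext a
    rw [nullForm, hE, hE, ← hμ, mulVec_smul, Pi.smul_apply, smul_eq_mul]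
    field_simp
  refine ⟨μ⁻¹ • l, smul_ne_zero (inv_ne_zero hμ0) hl.ne_zero, hf, ?_, ?_, ?_, fun a b => ?_⟩
  · rw [mulVec_smul, hl.mulVec_eq_zero, smul_zero]
  · rw [mulVec_smul, hl.dual_mulVec_eq_zero, smul_zero]
  · rw [mulVec_smul, dotProduct_smul, smul_dotProduct, hl.null, smul_zero, smul_zero]
  · rw [hf, hE, hE, ← hμ, mulVec_smul, Pi.smul_apply, Pi.smul_apply, smul_eq_mul, smul_eq_mul]
    field_simp

theorem contDiffOn_nullForm (h : IsNullAligned G X s q V)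
    (hn : ∀ y ∈ V, energy G X y n n ≠ 0) (a : Fin 4) :
    ContDiffOn ℝ 2 (fun z => nullForm G X n z a) V :=
  (h.contDiffOn_energy a n).div (h.contDiffOn_energy n n) hn

/-- The recurrence one-form of `nullForm`. -/
def recurrenceForm (G : E4 → Matrix (Fin 4) (Fin 4) ℝ) (X : E4 → Fin 4 → ℝ) (n : Fin 4) (y : E4)
    (e : Fin 4) : ℝ :=
  ∑ r, christoffel G y r e n * nullForm G X n y r

/-- In the quotient `T_{an} / T_{nn}` the factor `2α` of the recurrence cancels. The component `a =
n` is constantly `1`, so the recurrence form can be read off from `∇_e n_n = -Γ^r_{en} n_r`. -/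
theorem covDerivForm_nullForm (h : IsNullAligned G X s q V)
    (hn : ∀ y ∈ V, energy G X y n n ≠ 0) (hy : y ∈ V) (e a : Fin 4) :
    covDerivForm G (nullForm G X n) y e a = -(recurrenceForm G X n y e * nullForm G X n y a) := by
  obtain ⟨α, hα⟩ := h.exists_pd_energy hy
  obtain ⟨m, -, -, -, -, -, hE⟩ := h.exists_vector_nullForm hy (hn y hy)
  have h1 : pd e (fun z => nullForm G X n z a * energy G X z n n) y
      = pd e (fun z => energy G X z a n) y :=
    pd_congr h.metric.isOpen hy (fun z hz => div_mul_cancel₀ _ (hn z hz)) e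
  rw [pd_mul e (differentiableAt_of_contDiffOn (h.contDiffOn_nullForm hn a) (by norm_num)
    h.metric.isOpen hy) (differentiableAt_of_contDiffOn (h.contDiffOn_energy n n) (by norm_num)
    h.metric.isOpen hy), hα, hα] at h1
  have h2 : nullForm G X n y n = 1 := div_self (hn y hy)
  apply mul_right_cancel₀ (hn y hy)
  rw [covDerivForm, recurrenceForm]
  have e1 : ∀ a b, energy G X y a b
      = nullForm G X n y a * nullForm G X n y b * energy G X y n n := hE
  generalize energy G X y n n = t at *
  simp only [e1, h2, Fin.sum_univ_four] at h1 ⊢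
  linear_combination h1

theorem contDiffOn_recurrenceForm (h : IsNullAligned G X s q V)
    (hn : ∀ y ∈ V, energy G X y n n ≠ 0) (e : Fin 4) :
    ContDiffOn ℝ 2 (fun z => recurrenceForm G X n z e) V :=
  ContDiffOn.sum fun r _ =>
    (h.metric.contDiffOn_christoffel r e n).mul (h.contDiffOn_nullForm hn r)

theorem killingForm_contract_eq_zero (h : IsNullAligned G X s q V) (hy : y ∈ V) {m : Fin 4 → ℝ}
    (hF : of (covDerivLower G X y) *ᵥ m = 0)
    (hD : of (hodge G (s y) y (covDerivLower G X y)) *ᵥ m = 0) (c : Fin 4) :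
    ∑ r, (m r : ℂ) * killingForm G (s y) X y r c = 0 := by
  have h1 : ∑ r, covDerivLower G X y c r * m r = 0 := congrFun hF c
  have h2 : ∑ r, hodge G (s y) y (covDerivLower G X y) c r * m r = 0 := congrFun hD c
  have h3 : ∀ r, (m r : ℂ) * killingForm G (s y) X y r c =
      -(((covDerivLower G X y c r * m r : ℝ) : ℂ) + Complex.I *
        ((hodge G (s y) y (covDerivLower G X y) c r * m r : ℝ) : ℂ)) := by
    intro r
    rw [killingForm, eq_neg_of_add_eq_zero_left (h.killing y hy r c), hodge_antisymm _ _ _ _ r c]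
    push_cast
    ring
  simp only [h3, Finset.sum_neg_distrib, Finset.sum_add_distrib, ← Finset.mul_sum,
    ← Complex.ofReal_sum, h1, h2]
  simp

/-- In the Ricci identity for the null form the curvature term vanishes, because the principal
direction is annihilated by `ℱ` and the Riemann tensor is `Re (q ℱ ℱ)`. The component `n`, where the
form is `1`, leaves only the exterior derivative of the recurrence form, as the quadratic terms are
symmetric. -/
theorem recurrenceForm_closed (h : IsNullAligned G X s q V)
    (hn : ∀ y ∈ V, energy G X y n n ≠ 0) (hy : y ∈ V) (c a : Fin 4) :
    pd c (fun z => recurrenceForm G X n z a) y = pd a (fun z => recurrenceForm G X n z c) y := by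
  have hd : ∀ a, DifferentiableAt ℝ (fun z => nullForm G X n z a) y := fun a =>
    differentiableAt_of_contDiffOn (h.contDiffOn_nullForm hn a) (by norm_num) h.metric.isOpen hy
  have hw : ∀ a, DifferentiableAt ℝ (fun z => recurrenceForm G X n z a) y := fun a =>
    differentiableAt_of_contDiffOn (h.contDiffOn_recurrenceForm hn a) (by norm_num)
      h.metric.isOpen hy
  obtain ⟨m, -, hm, hF, hD, -, -⟩ := h.exists_vector_nullForm hy (hn y hy)
  have hR : ∑ r, nullForm G X n y r * riemannUp G y r n c a = 0 := by
    have h1 := h.metric.sum_lower_mul_riemannUp hy (fun _ => m) n c a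
    have h2 : ∀ r, lower G (fun _ => m) y r = nullForm G X n y r := fun r =>
      (congrFun hm r).symm
    simp only [h2] at h1
    rw [h1, h.sum_mul_riemann_eq hy, h.killingForm_contract_eq_zero hy hF hD]
    simp
  have hric := h.metric.ricci_identity hy (h.contDiffOn_nullForm hn) c a n
  rw [hR, neg_zero] at hric
  have hpd : ∀ c a, pd c (fun z => covDerivForm G (nullForm G X n) z a n) y =
      -(pd c (fun z => recurrenceForm G X n z a) y * nullForm G X n y n +
        recurrenceForm G X n y a * pd c (fun z => nullForm G X n z n) y) := by
    intro c a
    rw [pd_congr h.metric.isOpen hy (fun z hz => h.covDerivForm_nullForm hn hz a n) c, pd_neg,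
      pd_mul c (hw a) (hd n)]
  have h1 : nullForm G X n y n = 1 := div_self (hn y hy)
  have h0 : ∀ c, pd c (fun z => nullForm G X n z n) y = 0 := fun c => by
    rw [pd_congr h.metric.isOpen hy (f := fun z => nullForm G X n z n) (g := fun _ => 1)
      (fun z hz => div_self (hn z hz)), pd_const]
  simp only [covDerivTwo, hpd, h0, h1, h.covDerivForm_nullForm hn hy,
    h.metric.christoffel_symm hy _ c a] at hric
  have hrec : ∀ e, recurrenceForm G X n y e = ∑ r, christoffel G y r e n * nullForm G X n y r :=
    fun e => rfl
  have hs : ∀ c a, ∑ r, christoffel G y r c n * -(recurrenceForm G X n y a * nullForm G X n y r)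
      = -(recurrenceForm G X n y a * recurrenceForm G X n y c) := by
    intro c a
    rw [hrec c, Finset.mul_sum, ← Finset.sum_neg_distrib]
    exact Finset.sum_congr rfl fun r _ => by ring
  rw [hs, hs] at hric
  linarith

/-- Around every point there is a parallel null vector field spanning the principal null
direction. -/
theorem exists_parallel (h : IsNullAligned G X s q V) (hy : y ∈ V) :
    ∃ r > 0, Metric.ball y r ⊆ V ∧ ∃ (k : E4 → Fin 4 → ℝ) (c : ℝ),
      (∀ a, ContDiffOn ℝ 3 (fun z => k z a) (Metric.ball y r)) ∧
      ∀ z ∈ Metric.ball y r, k z ≠ 0 ∧ k z ⬝ᵥ G z *ᵥ k z = 0 ∧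
        (∀ a b, covDeriv G k z a b = 0) ∧ of (covDerivLower G X z) *ᵥ k z = 0 ∧
        X z ⬝ᵥ G z *ᵥ k z = c := by
  obtain ⟨l, hl⟩ := h.direction y hy
  -- The diagonal entries of `T` are the squares of the components of `g l`, which are not all zero.
  obtain ⟨n, hn⟩ : ∃ n, energy G X y n n ≠ 0 := by
    by_contra! hc
    apply hl.ne_zero
    have h0 : G y *ᵥ l = 0 := by
      ext a
      have := hc a
      rw [energy, hl.energy, vecMulVec_apply, mul_self_eq_zero] at this
      exact this
    rw [← one_mulVec l, ← h.metric.inv_mul hy, ← mulVec_mulVec, h0, mulVec_zero]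
  obtain ⟨r, hr, hball⟩ : ∃ r > 0, Metric.ball y r ⊆ V ∩ {z | energy G X z n n ≠ 0} := by
    have hcont : ContinuousAt (fun z => energy G X z n n) y :=
      ((h.contDiffOn_energy n n).continuousOn).continuousAt (h.metric.isOpen.mem_nhds hy)
    exact Metric.mem_nhds_iff.mp (Filter.inter_mem (h.metric.isOpen.mem_nhds hy)
      (hcont.eventually_ne hn))
  have hBV : Metric.ball y r ⊆ V := fun z hz => (hball hz).1
  have hBo : IsOpen (Metric.ball y r) := Metric.isOpen_ball
  refine ⟨r, hr, hBV, ?_⟩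
  replace h := h.mono hBo hBV
  replace hn : ∀ z ∈ Metric.ball y r, energy G X z n n ≠ 0 := fun z hz => (hball hz).2
  clear hy hBV hball hl
  obtain ⟨φ, hφd, hφ⟩ := exists_pd_eq_of_closed hBo (convex_ball y r)
    (fun a => (h.contDiffOn_recurrenceForm hn a).differentiableOn (by norm_num))
    (fun z hz a b => h.recurrenceForm_closed hn hz a b)
  -- Since `dφ` is the recurrence form, the factor `e^φ` compensates the recurrence.
  set κ : E4 → Fin 4 → ℝ := fun z a => Real.exp (φ z) * nullForm G X n z a with hκ
  have hfd : ∀ z ∈ Metric.ball y r, ∀ a, DifferentiableAt ℝ (fun z => nullForm G X n z a) z :=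
    fun z hz a => differentiableAt_of_contDiffOn (h.contDiffOn_nullForm hn a) (by norm_num) hBo hz
  have hφd' : ∀ z ∈ Metric.ball y r, DifferentiableAt ℝ φ z := fun z hz =>
    hφd.differentiableAt (hBo.mem_nhds hz)
  have hκd : ∀ z ∈ Metric.ball y r, ∀ a, DifferentiableAt ℝ (fun z => κ z a) z := fun z hz a =>
    (hφd' z hz).exp.fun_mul (hfd z hz a)
  have hκp : ∀ z ∈ Metric.ball y r, ∀ e a, covDerivForm G κ z e a = 0 := by
    intro z hz e a
    have h1 : pd e (fun z => Real.exp (φ z)) z = Real.exp (φ z) * recurrenceForm G X n z e := by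
      rw [← hφ z hz e, pd, fderiv_exp (hφd' z hz)]
      simp [pd]
    have h2 := h.covDerivForm_nullForm hn hz e a
    rw [covDerivForm] at h2
    rw [covDerivForm, hκ, pd_mul e (hφd' z hz).exp (hfd z hz a), h1]
    have h3 : ∑ c, christoffel G z c e a * (Real.exp (φ z) * nullForm G X n z c)
        = Real.exp (φ z) * ∑ c, christoffel G z c e a * nullForm G X n z c := by
      rw [Finset.mul_sum]
      exact Finset.sum_congr rfl fun c _ => by ring
    rw [h3]
    linear_combination Real.exp (φ z) * h2
  have hκpd : ∀ e a, ∀ z ∈ Metric.ball y r,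
      pd e (fun z => κ z a) z = ∑ c, christoffel G z c e a * κ z c := fun e a z hz =>
    sub_eq_zero.mp (hκp z hz e a)
  -- The construction only shows that `κ` is differentiable. But `∇κ = 0` reads `∂_e κ_a = Γ^c_{ea}
  -- κ_c` with `C^2` coefficients, so each pass gains one derivative, up to `C^3`.
  have hstep : ∀ m : ℕ, m ≤ 2 → (∀ a, ContDiffOn ℝ m (fun z => κ z a) (Metric.ball y r)) →
      ∀ a, ContDiffOn ℝ (m + 1 : ℕ) (fun z => κ z a) (Metric.ball y r) := by
    intro m hm hκm a
    refine contDiffOn_succ_of_pd hBo (fun z hz => (hκd z hz a).differentiableWithinAt) fun e => ?_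
    refine ContDiffOn.congr ?_ (hκpd e a)
    exact ContDiffOn.sum fun c _ => ((h.metric.contDiffOn_christoffel c e a).of_le
      (by exact_mod_cast hm)).mul (hκm c)
  have hκ3 : ∀ a, ContDiffOn ℝ 3 (fun z => κ z a) (Metric.ball y r) := by
    have h0 : ∀ a, ContDiffOn ℝ (0 : ℕ) (fun z => κ z a) (Metric.ball y r) := fun a => by
      rw [Nat.cast_zero, contDiffOn_zero]
      exact fun z hz => (hκd z hz a).continuousAt.continuousWithinAt
    exact hstep 2 (by norm_num) (hstep 1 (by norm_num) (hstep 0 (by norm_num) h0))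
  set k : E4 → Fin 4 → ℝ := fun z => (G z)⁻¹ *ᵥ κ z with hk
  have hk3 : ∀ a, ContDiffOn ℝ 3 (fun z => k z a) (Metric.ball y r) := fun a => by
    simp only [hk, mulVec, dotProduct]
    exact ContDiffOn.sum fun c _ => (h.metric.contDiffOn_inv a c).mul (hκ3 c)
  have hkd : ∀ z ∈ Metric.ball y r, ∀ a, DifferentiableAt ℝ (fun z => k z a) z := fun z hz a =>
    differentiableAt_of_contDiffOn (hk3 a) (by norm_num) hBo hz
  have hGk : ∀ z ∈ Metric.ball y r, G z *ᵥ k z = κ z := fun z hz => by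
    rw [hk, mulVec_mulVec, h.metric.mul_inv hz, one_mulVec]
  have hkpar : ∀ z ∈ Metric.ball y r, ∀ a b, covDeriv G k z a b = 0 := by
    intro z hz a b
    have h1 : G z *ᵥ (fun b => covDeriv G k z a b) = 0 := by
      ext b
      have h2 := h.metric.covDerivLower_eq_sum hz (hkd z hz) a b
      have h3 : covDerivLower G k z a b = covDerivForm G κ z a b := by
        rw [covDerivLower, covDerivForm,
          pd_congr hBo hz (f := fun w => lower G k w b) (g := fun w => κ w b)
            (fun w hw => congrFun (hGk w hw) b) a]
        congr 1
        exact Finset.sum_congr rfl fun c _ => congrArg _ (congrFun (hGk z hz) c)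
      rw [hκp z hz] at h3
      exact h2.symm.trans h3
    have h4 := congrArg (fun Z => (G z)⁻¹ *ᵥ Z) h1
    simp only [mulVec_mulVec, h.metric.inv_mul hz, one_mulVec, mulVec_zero] at h4
    exact congrFun h4 b
  have hdir : ∀ z ∈ Metric.ball y r, k z ≠ 0 ∧ k z ⬝ᵥ G z *ᵥ k z = 0 ∧
      of (covDerivLower G X z) *ᵥ k z = 0 := by
    intro z hz
    obtain ⟨m, hm0, hm, hF, -, hmn, -⟩ := h.exists_vector_nullForm hz (hn z hz)
    have hkm : k z = Real.exp (φ z) • m := by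
      have : κ z = Real.exp (φ z) • G z *ᵥ m := by rw [← hm]; rfl
      rw [hk]
      simp only [this]
      rw [mulVec_smul, mulVec_mulVec, h.metric.inv_mul hz, one_mulVec]
    rw [hkm]
    refine ⟨smul_ne_zero (Real.exp_ne_zero _) hm0, ?_, ?_⟩
    · rw [mulVec_smul, dotProduct_smul, smul_dotProduct, hmn, smul_zero, smul_zero]
    · rw [mulVec_smul, hF, smul_zero]
  have hpair : ∀ z ∈ Metric.ball y r,
      X z ⬝ᵥ G z *ᵥ k z = ∑ b, lower G X z b * k z b := by
    intro z hz
    rw [dotProduct_mulVec, ← mulVec_transpose, h.metric.transpose_eq hz]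
    rfl
  -- By the Leibniz rule `∂_a (ξ_b k^b) = F_{ab} k^b + ξ_b ∇_a k^b`, and both terms vanish.
  have hconst : ∀ z ∈ Metric.ball y r, fderiv ℝ (fun z => ∑ b, lower G X z b * k z b) z = 0 := by
    intro z hz
    ext v
    rw [fderiv_eq_sum_pd]
    refine Finset.sum_eq_zero fun a _ => ?_
    rw [IsMetricOn.pd_contraction (G := G) (fun b => differentiableAt_of_contDiffOn
      (h.metric.contDiffOn_lower h.contDiffOn b) (by norm_num) hBo hz) (hkd z hz)]
    have h1 : ∑ b, covDerivForm G (lower G X) z a b * k z b = 0 :=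
      congrFun (hdir z hz).2.2 a
    simp [h1, hkpar z hz]
  have hdiff : DifferentiableOn ℝ (fun z => ∑ b, lower G X z b * k z b) (Metric.ball y r) :=
    fun z hz => (DifferentiableAt.fun_sum fun b _ => (differentiableAt_of_contDiffOn
      (h.metric.contDiffOn_lower h.contDiffOn b) (by norm_num) hBo hz).fun_mul
        (hkd z hz b)).differentiableWithinAt
  refine ⟨k, ∑ b, lower G X y b * k y b, hk3, fun z hz => ⟨(hdir z hz).1, (hdir z hz).2.1,
    hkpar z hz, (hdir z hz).2.2, ?_⟩⟩
  rw [hpair z hz]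
  exact hBo.is_const_of_fderiv_eq_zero (convex_ball y r).isPreconnected hdiff hconst hz
    (Metric.mem_ball_self hr)

end IsNullAligned

/-! ### Covariance of the Levi-Civita derivative -/

/-- The lowered covariant derivative `g(∇_u X, v)`, by the Koszul formula. -/
def koszul (g : E4 → E4 →L[ℝ] E4 →L[ℝ] ℝ) (X : E4 → E4) (y u v : E4) : ℝ :=
  g y (fderiv ℝ X y u) v +
    (1 / 2) * (fderiv ℝ g y u v (X y) + fderiv ℝ g y (X y) v u - fderiv ℝ g y v u (X y))

/-- Here `g` is the pull-back of `g'` under `φ`, and `X`, `X'` are `φ`-related. The Koszul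
expression avoids both inverse metrics and the transformation law of the Christoffel symbols. -/
theorem koszul_comp {g g' : E4 → E4 →L[ℝ] E4 →L[ℝ] ℝ} {X X' : E4 → E4} {φ : E4 → E4} {y : E4}
    (hφ : ContDiffAt ℝ 2 φ y) (hg' : DifferentiableAt ℝ g' (φ y))
    (hX : DifferentiableAt ℝ X y) (hX' : DifferentiableAt ℝ X' (φ y))
    (hsymm : ∀ u v, g' (φ y) u v = g' (φ y) v u)
    (hg : ∀ᶠ z in nhds y, ∀ u v, g z u v = g' (φ z) (fderiv ℝ φ z u) (fderiv ℝ φ z v))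
    (hgd : DifferentiableAt ℝ g y)
    (hXX' : ∀ᶠ z in nhds y, X' (φ z) = fderiv ℝ φ z (X z)) (u v : E4) :
    koszul g X y u v = koszul g' X' (φ y) (fderiv ℝ φ y u) (fderiv ℝ φ y v) := by
  have hφd : HasFDerivAt φ (fderiv ℝ φ y) y :=
    (hφ.differentiableAt (by norm_num)).hasFDerivAt
  have hφ2 : HasFDerivAt (fderiv ℝ φ) (fderiv ℝ (fderiv ℝ φ) y) y :=
    ((hφ.fderiv_right (m := 1) (by norm_num)).differentiableAt (by norm_num)).hasFDerivAt
  have hs : ∀ u v, fderiv ℝ (fderiv ℝ φ) y u v = fderiv ℝ (fderiv ℝ φ) y v u :=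
    hφ.isSymmSndFDerivAt (by simp)
  have hDg : ∀ w u v, fderiv ℝ g y w u v =
      fderiv ℝ g' (φ y) (fderiv ℝ φ y w) (fderiv ℝ φ y u) (fderiv ℝ φ y v)
      + g' (φ y) (fderiv ℝ (fderiv ℝ φ) y w u) (fderiv ℝ φ y v)
      + g' (φ y) (fderiv ℝ φ y u) (fderiv ℝ (fderiv ℝ φ) y w v) := by
    intro w u v
    have h1 : HasFDerivAt (fun z => g z u v) _ y :=
      (hgd.hasFDerivAt.clm_apply (hasFDerivAt_const u y)).clm_apply (hasFDerivAt_const v y)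
    have h2 : HasFDerivAt (fun z => g' (φ z) (fderiv ℝ φ z u) (fderiv ℝ φ z v)) _ y :=
      ((hg'.hasFDerivAt.comp y hφd).clm_apply
        (hφ2.clm_apply (hasFDerivAt_const u y))).clm_apply (hφ2.clm_apply (hasFDerivAt_const v y))
    have h3 := h1.unique (h2.congr_of_eventuallyEq (hg.mono fun z hz => hz u v))
    have h4 := congrArg (fun L => L w) h3
    simp at h4
    rw [h4]
    ring
  have hDX : ∀ u, fderiv ℝ X' (φ y) (fderiv ℝ φ y u) =
      fderiv ℝ φ y (fderiv ℝ X y u) + fderiv ℝ (fderiv ℝ φ) y u (X y) := by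
    intro u
    have h1 : HasFDerivAt (fun z => X' (φ z)) _ y := hX'.hasFDerivAt.comp y hφd
    have h2 : HasFDerivAt (fun z => fderiv ℝ φ z (X z)) _ y := hφ2.clm_apply hX.hasFDerivAt
    have h3 := h1.unique (h2.congr_of_eventuallyEq hXX')
    have h4 := congrArg (fun L => L u) h3
    simpa using h4
  have hXy : X' (φ y) = fderiv ℝ φ y (X y) := hXX'.self_of_nhds
  have hgy := hg.self_of_nhds
  -- What remains are terms in the second derivative of `φ`; they cancel by its symmetry and that of
  -- `g'`.
  rw [koszul, koszul, hDX, hXy, hDg, hDg, hDg, hgy, hs (X y) v, hs (X y) u, hs v u]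
  simp only [map_add, _root_.add_apply]
  rw [hsymm (fderiv ℝ φ y u) (fderiv ℝ (fderiv ℝ φ) y v (X y)),
    hsymm (fderiv ℝ φ y v) (fderiv ℝ (fderiv ℝ φ) y u (X y))]
  ring

/-- The bilinear form of a matrix. -/
def bilin (A : Matrix (Fin 4) (Fin 4) ℝ) : E4 →L[ℝ] E4 →L[ℝ] ℝ :=
  ∑ a, ∑ b, A a b • (EuclideanSpace.proj a : E4 →L[ℝ] ℝ).smulRight
    (EuclideanSpace.proj b : E4 →L[ℝ] ℝ)

theorem bilin_apply (A : Matrix (Fin 4) (Fin 4) ℝ) (u v : E4) :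
    bilin A u v = ∑ a, ∑ b, A a b * (u a * v b) := by
  simp [bilin]

theorem bilin_apply_eq_dotProduct (A : Matrix (Fin 4) (Fin 4) ℝ) (u v : E4) :
    bilin A u v = u.ofLp ⬝ᵥ A *ᵥ v.ofLp := by
  simp only [bilin_apply, dotProduct, mulVec, Finset.mul_sum]
  exact Finset.sum_congr rfl fun a _ => Finset.sum_congr rfl fun b _ => by ring

theorem hasFDerivAt_smul_vec {F : Type*} [NormedAddCommGroup F] [NormedSpace ℝ F]
    {f : E4 → ℝ} {y : E4} (hf : DifferentiableAt ℝ f y) (c : F) :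
    HasFDerivAt (fun z => f z • c) ((fderiv ℝ f y).smulRight c) y :=
  hf.hasFDerivAt.smul_const c

theorem hasFDerivAt_bilin {A : E4 → Matrix (Fin 4) (Fin 4) ℝ} {y : E4}
    (hA : ∀ a b, DifferentiableAt ℝ (fun z => A z a b) y) :
    HasFDerivAt (fun z => bilin (A z)) (∑ a, ∑ b, (fderiv ℝ (fun z => A z a b) y).smulRight
      ((EuclideanSpace.proj a : E4 →L[ℝ] ℝ).smulRight (EuclideanSpace.proj b : E4 →L[ℝ] ℝ))) y :=
  HasFDerivAt.fun_sum fun a _ => HasFDerivAt.fun_sum fun b _ =>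
    hasFDerivAt_smul_vec (hA a b)
      ((EuclideanSpace.proj a : E4 →L[ℝ] ℝ).smulRight (EuclideanSpace.proj b : E4 →L[ℝ] ℝ))

theorem fderiv_bilin_apply {A : E4 → Matrix (Fin 4) (Fin 4) ℝ} {y : E4}
    (hA : ∀ a b, DifferentiableAt ℝ (fun z => A z a b) y) (w u v : E4) :
    fderiv ℝ (fun z => bilin (A z)) y w u v =
      ∑ a, ∑ b, (∑ c, w c * pd c (fun z => A z a b) y) * (u a * v b) := by
  rw [(hasFDerivAt_bilin hA).fderiv]
  simp [fderiv_eq_sum_pd]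

theorem IsMetricOn.koszul_eq {G : E4 → Matrix (Fin 4) (Fin 4) ℝ} {V : Set E4} {y : E4}
    (hG : IsMetricOn G V) (hy : y ∈ V) {X : E4 → Fin 4 → ℝ}
    (hX : ∀ a, DifferentiableAt ℝ (fun z => X z a) y) (u v : E4) :
    koszul (fun z => bilin (G z)) (fun z => WithLp.toLp 2 (X z)) y u v =
      ∑ a, ∑ b, u a * v b * covDerivLower G X y a b := by
  have hg : ∀ a b, DifferentiableAt ℝ (fun z => G z a b) y := fun a b =>
    differentiableAt_of_contDiffOn (hG.contDiffOn a b) (by norm_num) hG.isOpen hy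
  have hXd : DifferentiableAt ℝ (fun z => (WithLp.toLp 2 (X z) : E4)) y := by
    rw [differentiableAt_euclidean]
    exact hX
  have hDX : ∀ u b, (fderiv ℝ (fun z => (WithLp.toLp 2 (X z) : E4)) y u) b
      = ∑ a, u a * pd a (fun z => X z b) y := by
    intro u b
    have h1 : HasFDerivAt (fun z => X z b) ((EuclideanSpace.proj b : E4 →L[ℝ] ℝ).comp
        (fderiv ℝ (fun z => (WithLp.toLp 2 (X z) : E4)) y)) y :=
      (EuclideanSpace.proj b : E4 →L[ℝ] ℝ).hasFDerivAt.comp y hXd.hasFDerivAt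
    rw [← fderiv_eq_sum_pd, h1.fderiv]
    rfl
  have hC : ∀ a b, covDerivLower G X y a b = ∑ c, G y c b * pd a (fun z => X z c) y
      + ∑ c, (1 / 2) * (pd a (fun z => G z b c) y + pd c (fun z => G z b a) y
        - pd b (fun z => G z a c) y) * X y c := by
    intro a b
    rw [hG.covDerivLower_eq_sum hy hX, ← Finset.sum_congr rfl fun c _ =>
      congrArg (· * X y c) (hG.mul_christoffelMatrix hy a b c)]
    simp only [covDeriv, mul_add, Finset.sum_add_distrib, Matrix.mul_apply, christoffelMatrix,
      Matrix.of_apply, Finset.sum_mul, Finset.mul_sum]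
    congr 1
    · exact Finset.sum_congr rfl fun c _ => by rw [hG.symm y hy]
    rw [Finset.sum_comm]
    exact Finset.sum_congr rfl fun a _ => Finset.sum_congr rfl fun b _ => by ring
  rw [koszul, fderiv_bilin_apply hg, fderiv_bilin_apply hg, fderiv_bilin_apply hg, bilin_apply]
  simp only [hC, hDX]
  simp only [Fin.sum_univ_four]
  ring

end Coord

end

noncomputable section

open Matrix VectorField

/-! ### Vector fields and their components in a chart -/

section Charts

variable {M : Type*} [TopologicalSpace M] [ChartedSpace E4 M]
  {e : OpenPartialHomeomorph M E4} {y : E4}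

theorem mdifferentiable_of_mem_maximalAtlas (he : e ∈ IsManifold.maximalAtlas (𝓡 4) ∞ M) :
    e.MDifferentiable (𝓡 4) (𝓡 4) :=
  ⟨(contMDiffOn_of_mem_maximalAtlas he).mdifferentiableOn (by simp),
    (contMDiffOn_symm_of_mem_maximalAtlas he).mdifferentiableOn (by simp)⟩

theorem mfderiv_comp_mfderiv_symm (he : e ∈ IsManifold.maximalAtlas (𝓡 4) ∞ M)
    (hy : y ∈ e.target) :
    (mfderiv (𝓡 4) (𝓡 4) e (e.symm y)).comp (mfderiv (𝓡 4) (𝓡 4) e.symm y)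
      = ContinuousLinearMap.id ℝ (TangentSpace (𝓡 4) y) :=
  (mdifferentiable_of_mem_maximalAtlas he).comp_symm_deriv hy

theorem mfderiv_symm_comp_mfderiv (he : e ∈ IsManifold.maximalAtlas (𝓡 4) ∞ M)
    (hy : y ∈ e.target) :
    (mfderiv (𝓡 4) (𝓡 4) e.symm y).comp (mfderiv (𝓡 4) (𝓡 4) e (e.symm y))
      = ContinuousLinearMap.id ℝ (TangentSpace (𝓡 4) (e.symm y)) := by
  have := (mdifferentiable_of_mem_maximalAtlas he).symm_comp_deriv (e.map_target hy)
  rwa [e.right_inv hy] at this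

theorem isInvertible_mfderiv (he : e ∈ IsManifold.maximalAtlas (𝓡 4) ∞ M) (hy : y ∈ e.target) :
    (mfderiv (𝓡 4) (𝓡 4) e (e.symm y)).IsInvertible :=
  ContinuousLinearMap.IsInvertible.of_inverse (M := E4) (M₂ := E4)
    (mfderiv_comp_mfderiv_symm he hy) (mfderiv_symm_comp_mfderiv he hy)

theorem isInvertible_mfderiv_symm (he : e ∈ IsManifold.maximalAtlas (𝓡 4) ∞ M)
    (hy : y ∈ e.target) : (mfderiv (𝓡 4) (𝓡 4) e.symm y).IsInvertible :=
  ContinuousLinearMap.IsInvertible.of_inverse (M := E4) (M₂ := E4)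
    (mfderiv_symm_comp_mfderiv he hy) (mfderiv_comp_mfderiv_symm he hy)

theorem inverse_mfderiv_apply (he : e ∈ IsManifold.maximalAtlas (𝓡 4) ∞ M) (hy : y ∈ e.target)
    (u : E4) :
    (mfderiv (𝓡 4) (𝓡 4) e (e.symm y)).inverse u = mfderiv (𝓡 4) (𝓡 4) e.symm y u := by
  have h : (mfderiv (𝓡 4) (𝓡 4) e (e.symm y)).inverse = mfderiv (𝓡 4) (𝓡 4) e.symm y :=
    ContinuousLinearMap.inverse_eq (M := E4) (M₂ := E4)
      (mfderiv_comp_mfderiv_symm he hy) (mfderiv_symm_comp_mfderiv he hy)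
  exact congrArg (fun L : E4 →L[ℝ] E4 => L u) h

theorem inverse_mfderiv_symm_apply (he : e ∈ IsManifold.maximalAtlas (𝓡 4) ∞ M)
    (hy : y ∈ e.target) (v : TangentSpace (𝓡 4) (e.symm y)) :
    (mfderiv (𝓡 4) (𝓡 4) e.symm y).inverse v = mfderiv (𝓡 4) (𝓡 4) e (e.symm y) v := by
  have h : (mfderiv (𝓡 4) (𝓡 4) e.symm y).inverse = mfderiv (𝓡 4) (𝓡 4) e (e.symm y) :=
    ContinuousLinearMap.inverse_eq (M := E4) (M₂ := E4)
      (mfderiv_symm_comp_mfderiv he hy) (mfderiv_comp_mfderiv_symm he hy)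
  exact congrArg (fun L : E4 →L[ℝ] E4 => L v) h

/-- The components of a vector field as an element of the model space. -/
def vectorRep (e : OpenPartialHomeomorph M E4) (X : ∀ x : M, TangentSpace (𝓡 4) x) (y : E4) : E4 :=
  mfderiv (𝓡 4) (𝓡 4) e (e.symm y) (X (e.symm y))

theorem toLp_vectorComp (X : ∀ x : M, TangentSpace (𝓡 4) x) :
    WithLp.toLp 2 (vectorComp e X y) = vectorRep e X y := rfl

theorem mfderiv_symm_vectorRep (he : e ∈ IsManifold.maximalAtlas (𝓡 4) ∞ M) (hy : y ∈ e.target)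
    (X : ∀ x : M, TangentSpace (𝓡 4) x) :
    mfderiv (𝓡 4) (𝓡 4) e.symm y (vectorRep e X y) = X (e.symm y) :=
  congrArg (fun L : E4 →L[ℝ] E4 => L (X (e.symm y))) (mfderiv_symm_comp_mfderiv he hy)

/-- The vector field whose components in the chart `e` are given by `k`. -/
def ofComp (e : OpenPartialHomeomorph M E4) (k : E4 → E4) (x : M) : TangentSpace (𝓡 4) x :=
  mpullback (𝓡 4) (𝓡 4) e k x

theorem vectorRep_ofComp (he : e ∈ IsManifold.maximalAtlas (𝓡 4) ∞ M) (hy : y ∈ e.target)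
    (k : E4 → E4) : vectorRep e (ofComp e k) y = k y := by
  have h1 : ofComp e k (e.symm y) = mfderiv (𝓡 4) (𝓡 4) e.symm y (k y) := by
    refine (inverse_mfderiv_apply he hy (k (e (e.symm y)))).trans ?_
    rw [e.right_inv hy]
  rw [vectorRep, h1]
  exact congrArg (fun L : E4 →L[ℝ] E4 => L (k y)) (mfderiv_comp_mfderiv_symm he hy)

variable [IsManifold (𝓡 4) ∞ M]

theorem contDiffAt_vectorRep (he : e ∈ IsManifold.maximalAtlas (𝓡 4) ∞ M) (hy : y ∈ e.target)
    {X : ∀ x : M, TangentSpace (𝓡 4) x}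
    (hX : ContMDiffAt (𝓡 4) (𝓡 4).tangent 3
      (fun x => (⟨x, X x⟩ : TangentBundle (𝓡 4) M)) (e.symm y)) :
    ContDiffAt ℝ 3 (vectorRep e X) y := by
  have h1 : ContMDiffAt (𝓡 4) (𝓡 4).tangent 3
      (fun z => (⟨z, mpullback (𝓡 4) (𝓡 4) e.symm X z⟩ : TangentBundle (𝓡 4) E4)) y :=
    ContMDiffAt.mpullback_vectorField_preimage (n := ∞) hX
      (contMDiffAt_symm_of_mem_maximalAtlas he hy) (isInvertible_mfderiv_symm he hy) (by norm_cast)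
  have h2 : ContDiffAt ℝ 3 (fun z => (mpullback (𝓡 4) (𝓡 4) e.symm X z : E4)) y :=
    contMDiffAt_vectorSpace_iff_contDiffAt.mp h1
  refine h2.congr_of_eventuallyEq ?_
  filter_upwards [e.open_target.mem_nhds hy] with z hz
  exact (inverse_mfderiv_symm_apply he hz _).symm

theorem contMDiffAt_ofComp (he : e ∈ IsManifold.maximalAtlas (𝓡 4) ∞ M) (hy : y ∈ e.target)
    {k : E4 → E4} (hk : ContDiffAt ℝ 3 k y) :
    ContMDiffAt (𝓡 4) (𝓡 4).tangent 3
      (fun x => (⟨x, ofComp e k x⟩ : TangentBundle (𝓡 4) M)) (e.symm y) := by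
  have hk' : ContDiffAt ℝ 3 k (e (e.symm y)) := by rwa [e.right_inv hy]
  have h1 : ContMDiffAt (𝓡 4) (𝓡 4).tangent 3
      (fun z => (⟨z, k z⟩ : TangentBundle (𝓡 4) E4)) (e (e.symm y)) :=
    contMDiffAt_vectorSpace_iff_contDiffAt.mpr hk'
  exact ContMDiffAt.mpullback_vectorField_preimage (n := ∞) h1
    (contMDiffAt_of_mem_maximalAtlas he (e.map_target hy)) (isInvertible_mfderiv he hy)
    (by norm_cast)

end Charts

end

noncomputable section

open Matrix VectorField Coord

/-! ### The metric and the hypotheses in a chart -/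

namespace Spacetime

variable {M : Type*} [TopologicalSpace M] [ChartedSpace E4 M] [IsManifold (𝓡 4) ∞ M]
  {e : OpenPartialHomeomorph M E4} {y : E4} (S : Spacetime M)

theorem bilin_comp_apply (e : OpenPartialHomeomorph M E4) (y u v : E4) :
    bilin (S.comp e y) u v = S.metric (e.symm y) (mfderiv (𝓡 4) (𝓡 4) e.symm y u)
      (mfderiv (𝓡 4) (𝓡 4) e.symm y v) := by
  have hv : ∀ v : E4, v = ∑ a, v a • (EuclideanSpace.single a (1 : ℝ) : E4) := by
    intro v
    ext i
    simp [Pi.single_apply]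
  have hd : ∀ v : E4, mfderiv (𝓡 4) (𝓡 4) e.symm y v = ∑ a, v a • coordVector e y a := by
    intro v
    let L : E4 →L[ℝ] TangentSpace (𝓡 4) (e.symm y) := mfderiv (𝓡 4) (𝓡 4) e.symm y
    change L v = ∑ a, v a • L (EuclideanSpace.single a (1 : ℝ))
    conv_lhs => rw [hv v]
    rw [map_sum]
    exact Finset.sum_congr rfl fun a _ => map_smul L _ _
  rw [hd u, hd v, bilin_apply]
  simp only [map_sum, map_smul, _root_.sum_apply, _root_.smul_apply, smul_eq_mul]
  rw [Finset.sum_comm]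
  refine Finset.sum_congr rfl fun a _ => ?_
  rw [Finset.mul_sum]
  refine Finset.sum_congr rfl fun b _ => ?_
  simp only [comp, Matrix.of_apply]
  ring

theorem bilin_comp_vectorRep (he : e ∈ IsManifold.maximalAtlas (𝓡 4) ∞ M) (hy : y ∈ e.target)
    (X Y : ∀ x : M, TangentSpace (𝓡 4) x) :
    bilin (S.comp e y) (vectorRep e X y) (vectorRep e Y y)
      = S.metric (e.symm y) (X (e.symm y)) (Y (e.symm y)) := by
  rw [bilin_comp_apply, mfderiv_symm_vectorRep he hy, mfderiv_symm_vectorRep he hy]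

theorem contMDiffAt_metric_apply {X Y : ∀ x : M, TangentSpace (𝓡 4) x} {x : M}
    (hX : ContMDiffAt (𝓡 4) (𝓡 4).tangent 3 (fun x => (⟨x, X x⟩ : TangentBundle (𝓡 4) M)) x)
    (hY : ContMDiffAt (𝓡 4) (𝓡 4).tangent 3 (fun x => (⟨x, Y x⟩ : TangentBundle (𝓡 4) M)) x) :
    ContMDiffAt (𝓡 4) 𝓘(ℝ) 3 (fun x => S.metric x (X x) (Y x)) x := by
  have : ContMDiffAt (𝓡 4) ((𝓡 4).prod 𝓘(ℝ)) 3
      (fun m => Bundle.TotalSpace.mk' ℝ (E := Bundle.Trivial M ℝ) m (S.metric m (X m) (Y m))) x := by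
    apply ContMDiffAt.clm_bundle_apply₂ (F₁ := E4) (F₂ := E4)
    · exact S.contMDiff_metric x
    · exact hX
    · exact hY
  simp only [Bundle.contMDiffAt_totalSpace] at this
  exact this.2

theorem contDiffAt_comp (he : e ∈ IsManifold.maximalAtlas (𝓡 4) ∞ M) (hy : y ∈ e.target)
    (a b : Fin 4) : ContDiffAt ℝ 3 (fun z => S.comp e z a b) y := by
  -- The coordinate vector fields are the fields with constant components, so the regularity of
  -- `g(∂_a, ∂_b)` follows from that of `g` on vector fields.
  have h0 : ∀ a : Fin 4, ContMDiffAt (𝓡 4) (𝓡 4).tangent 3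
      (fun x => (⟨x, ofComp e (fun _ => EuclideanSpace.single a 1) x⟩ : TangentBundle (𝓡 4) M))
      (e.symm y) := fun a => contMDiffAt_ofComp he hy contDiffAt_const
  have h1 := (S.contMDiffAt_metric_apply (h0 a) (h0 b)).comp y
    ((contMDiffAt_symm_of_mem_maximalAtlas he hy).of_le (by norm_cast))
  refine h1.contDiffAt.congr_of_eventuallyEq ?_
  filter_upwards [e.open_target.mem_nhds hy] with z hz
  have h2 := S.bilin_comp_vectorRep he hz (ofComp e (fun _ => EuclideanSpace.single a 1))
    (ofComp e (fun _ => EuclideanSpace.single b 1))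
  rw [vectorRep_ofComp he hz, vectorRep_ofComp he hz, bilin_comp_apply] at h2
  exact h2

theorem exists_frame (he : e ∈ IsManifold.maximalAtlas (𝓡 4) ∞ M) (hy : y ∈ e.target) :
    ∃ B : Matrix (Fin 4) (Fin 4) ℝ, Bᵀ * S.comp e y * B = minkowski := by
  obtain ⟨b, hb⟩ := S.lorentzian (e.symm y)
  let w : Fin 4 → E4 := fun i => mfderiv (𝓡 4) (𝓡 4) e (e.symm y) (b i)
  have hw : ∀ i, mfderiv (𝓡 4) (𝓡 4) e.symm y (w i) = b i := fun i =>
    congrArg (fun L : E4 →L[ℝ] E4 => L (b i)) (mfderiv_symm_comp_mfderiv he hy)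
  have hij : ∀ i j, bilin (S.comp e y) (w i) (w j)
      = if i = j then (if i = 0 then -1 else 1) else 0 := fun i j => by
    rw [bilin_comp_apply, hw, hw, hb]
  refine ⟨of fun a i => w i a, ?_⟩
  ext i j
  have h1 : ((of fun a i => w i a)ᵀ * S.comp e y * (of fun a i => w i a)) i j
      = bilin (S.comp e y) (w i) (w j) := by
    rw [bilin_apply_eq_dotProduct, Matrix.mul_assoc]
    rfl
  rw [h1, hij]
  fin_cases i <;> fin_cases j <;> simp [minkowski]

theorem isMetricOn_comp (he : e ∈ IsManifold.maximalAtlas (𝓡 4) ∞ M) :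
    IsMetricOn (S.comp e) e.target where
  isOpen := e.open_target
  contDiffOn a b := fun y hy => (S.contDiffAt_comp he hy a b).contDiffWithinAt
  symm y hy a b := S.symm _ _ _
  isUnit_det y hy := by
    obtain ⟨B, hB⟩ := S.exists_frame he hy
    have := congrArg Matrix.det hB
    rw [det_mul, det_mul, det_minkowski] at this
    rw [isUnit_iff_ne_zero]
    intro h0
    simp [h0] at this

variable {S}

theorem isNullAligned (hvac : S.IsVacuum)
    {ξ : ∀ x : M, TangentSpace (𝓡 4) x} (hξ : S.IsKilling ξ)
    (hnull : S.KillingFormNull ξ) (hne : S.KillingFormNowhereZero ξ)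
    {Q : M → ℂ} (hQ : S.WeylAligned ξ Q) (he : e ∈ IsManifold.maximalAtlas (𝓡 4) ∞ M) :
    IsNullAligned (S.comp e) (vectorComp e ξ) (fun y => S.orientation.sign e (e.symm y))
      (fun y => Q (e.symm y)) e.target where
  metric := S.isMetricOn_comp he
  contDiffOn a := fun y hy =>
    ((contDiffAt_euclidean.mp (contDiffAt_vectorRep he hy (hξ.1 _))) a).contDiffWithinAt
  killing := hξ.2 e he
  ricci := hvac e he
  aligned := hQ e he
  direction y hy := by
    obtain ⟨B, hB⟩ := S.exists_frame he hy
    exact exists_isNullDirection (S.orientation.sign_eq e he _ (e.map_target hy)) hB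
      (hξ.2 e he y hy) (hnull e he y hy) (hne e he y hy)

end Spacetime

/-! ### Change of chart -/

section Charts

variable {M : Type*} [TopologicalSpace M] [ChartedSpace E4 M]
  {e e' : OpenPartialHomeomorph M E4} {y : E4}

theorem vectorRep_apply (X : ∀ x : M, TangentSpace (𝓡 4) x) {x : M} (hx : x ∈ e.source) :
    vectorRep e X (e x) = mfderiv (𝓡 4) (𝓡 4) e x (X x) := by
  rw [vectorRep, e.left_inv hx]

theorem fderiv_transition (he : e ∈ IsManifold.maximalAtlas (𝓡 4) ∞ M)
    (he' : e' ∈ IsManifold.maximalAtlas (𝓡 4) ∞ M) (hy : y ∈ e.target)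
    (hy' : e.symm y ∈ e'.source) (u : E4) :
    fderiv ℝ (fun z => e' (e.symm z)) y u
      = mfderiv (𝓡 4) (𝓡 4) e' (e.symm y) (mfderiv (𝓡 4) (𝓡 4) e.symm y u) := by
  have h := mfderiv_comp (I := 𝓡 4) (I' := 𝓡 4) (I'' := 𝓡 4) y
    ((mdifferentiable_of_mem_maximalAtlas he').mdifferentiableAt hy')
    ((mdifferentiable_of_mem_maximalAtlas he).mdifferentiableAt_symm hy)
  rw [mfderiv_eq_fderiv] at h
  exact congrArg (fun L : E4 →L[ℝ] E4 => L u) h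

theorem eq_of_vectorRep_eq (he : e ∈ IsManifold.maximalAtlas (𝓡 4) ∞ M) (hy : y ∈ e.target)
    {X k : ∀ x : M, TangentSpace (𝓡 4) x}
    (h : vectorRep e X y = vectorRep e k y) : X (e.symm y) = k (e.symm y) := by
  rw [← mfderiv_symm_vectorRep he hy X, h, mfderiv_symm_vectorRep he hy k]

end Charts

namespace Spacetime

variable {M : Type*} [TopologicalSpace M] [ChartedSpace E4 M] [IsManifold (𝓡 4) ∞ M]
  {e e' : OpenPartialHomeomorph M E4} {y : E4} {S : Spacetime M}

theorem bilin_comp_mfderiv (he : e ∈ IsManifold.maximalAtlas (𝓡 4) ∞ M) {x : M} (hx : x ∈ e.source)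
    (v w : TangentSpace (𝓡 4) x) :
    bilin (S.comp e (e x)) (mfderiv (𝓡 4) (𝓡 4) e x v) (mfderiv (𝓡 4) (𝓡 4) e x w)
      = S.metric x v w := by
  obtain ⟨y, hy, rfl⟩ : ∃ y ∈ e.target, e.symm y = x := ⟨e x, e.map_source hx, e.left_inv hx⟩
  have h : ∀ v : TangentSpace (𝓡 4) (e.symm y),
      mfderiv (𝓡 4) (𝓡 4) e.symm y (mfderiv (𝓡 4) (𝓡 4) e (e.symm y) v) = v := fun v =>
    congrArg (fun L : E4 →L[ℝ] E4 => L v) (mfderiv_symm_comp_mfderiv he hy)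
  rw [e.right_inv hy]
  refine (S.bilin_comp_apply e y _ _).trans ?_
  exact congrArg₂ (fun p q : TangentSpace (𝓡 4) (e.symm y) => S.metric (e.symm y) p q) (h v) (h w)

/-- The lowered covariant derivative of a vector field does not depend on the chart. -/
theorem covDerivLower_transition (he : e ∈ IsManifold.maximalAtlas (𝓡 4) ∞ M)
    (he' : e' ∈ IsManifold.maximalAtlas (𝓡 4) ∞ M) (hy : y ∈ e.target)
    (hy' : e.symm y ∈ e'.source) {X : ∀ x : M, TangentSpace (𝓡 4) x}
    (hX : ContMDiffAt (𝓡 4) (𝓡 4).tangent 3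
      (fun x => (⟨x, X x⟩ : TangentBundle (𝓡 4) M)) (e.symm y)) (u v : E4) :
    ∑ a, ∑ b, u a * v b * covDerivLower (S.comp e) (vectorComp e X) y a b =
      ∑ a, ∑ b, (fderiv ℝ (fun z => e' (e.symm z)) y u) a *
        (fderiv ℝ (fun z => e' (e.symm z)) y v) b *
        covDerivLower (S.comp e') (vectorComp e' X) (e' (e.symm y)) a b := by
  have hyt : e' (e.symm y) ∈ e'.target := e'.map_source hy'
  have hX' : ContMDiffAt (𝓡 4) (𝓡 4).tangent 3
      (fun x => (⟨x, X x⟩ : TangentBundle (𝓡 4) M)) (e'.symm (e' (e.symm y))) := by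
    rwa [e'.left_inv hy']
  have hd := (contDiffAt_vectorRep he hy hX).differentiableAt (by norm_num)
  have hd' := (contDiffAt_vectorRep he' hyt hX').differentiableAt (by norm_num)
  have hk := (S.isMetricOn_comp he).koszul_eq (X := vectorComp e X) hy
    (differentiableAt_euclidean.mp hd) u v
  have hk' := (S.isMetricOn_comp he').koszul_eq (X := vectorComp e' X) hyt
    (differentiableAt_euclidean.mp hd') (fderiv ℝ (fun z => e' (e.symm z)) y u)
    (fderiv ℝ (fun z => e' (e.symm z)) y v)
  rw [← hk, ← hk']
  have hev : ∀ᶠ z in nhds y, z ∈ e.target ∧ e.symm z ∈ e'.source :=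
    (e.open_target.eventually_mem hy).and
      ((e.continuousAt_symm hy).eventually (e'.open_source.mem_nhds hy'))
  have hdiff : ∀ {e : OpenPartialHomeomorph M E4} (he : e ∈ IsManifold.maximalAtlas (𝓡 4) ∞ M)
      {y : E4} (hy : y ∈ e.target), DifferentiableAt ℝ (fun z => bilin (S.comp e z)) y :=
    fun he y hy => (hasFDerivAt_bilin fun a b =>
      (S.contDiffAt_comp he hy a b).differentiableAt (by norm_num)).differentiableAt
  refine koszul_comp (φ := fun z => e' (e.symm z)) ?_ (hdiff he' hyt) hd hd' ?_ ?_ (hdiff he hy)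
    ?_ u v
  · have := ((contMDiffAt_of_mem_maximalAtlas he' hy').comp y
      (contMDiffAt_symm_of_mem_maximalAtlas he hy)).contDiffAt
    exact this.of_le (by norm_cast)
  · intro u v
    rw [bilin_comp_apply, bilin_comp_apply]
    exact S.symm _ _ _
  · filter_upwards [hev] with z hz u v
    rw [fderiv_transition he he' hz.1 hz.2, fderiv_transition he he' hz.1 hz.2,
      bilin_comp_mfderiv he' hz.2, bilin_comp_apply]
  · filter_upwards [hev] with z hz
    rw [fderiv_transition he he' hz.1 hz.2]
    refine (vectorRep_apply X hz.2).trans ?_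
    congr 1
    exact (mfderiv_symm_vectorRep he hz.1 X).symm

end Spacetime

/-! ### The bracket of a Killing field with a parallel field -/

namespace Coord

variable {G : E4 → Matrix (Fin 4) (Fin 4) ℝ} {V : Set E4} {y : E4} {X k : E4 → Fin 4 → ℝ}

theorem IsMetricOn.eq_zero_of_mulVec_eq_zero (hG : IsMetricOn G V) (hy : y ∈ V) {v : Fin 4 → ℝ}
    (hv : G y *ᵥ v = 0) : v = 0 := by
  have h := congrArg (fun Z => (G y)⁻¹ *ᵥ Z) hv
  simpa only [mulVec_mulVec, hG.inv_mul hy, one_mulVec, mulVec_zero] using h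

theorem IsMetricOn.covDeriv_eq_zero (hG : IsMetricOn G V) (hy : y ∈ V)
    (hk : ∀ a, DifferentiableAt ℝ (fun z => k z a) y)
    (h : ∀ a b, covDerivLower G k y a b = 0) (a b : Fin 4) : covDeriv G k y a b = 0 := by
  refine congrFun (hG.eq_zero_of_mulVec_eq_zero hy (v := fun b => covDeriv G k y a b) ?_) b
  ext b
  exact (hG.covDerivLower_eq_sum hy hk a b).symm.trans (h a b)

theorem fderiv_toLp_apply (hX : ∀ a, DifferentiableAt ℝ (fun z => X z a) y) (u : E4) (b : Fin 4) :
    (fderiv ℝ (fun z => (WithLp.toLp 2 (X z) : E4)) y u) b = ∑ a, u a * pd a (fun z => X z b) y := by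
  have hd : DifferentiableAt ℝ (fun z => (WithLp.toLp 2 (X z) : E4)) y :=
    differentiableAt_euclidean.mpr hX
  have h := (EuclideanSpace.proj b : E4 →L[ℝ] ℝ).hasFDerivAt.comp y
    hd.hasFDerivAt
  rw [← fderiv_eq_sum_pd]
  exact congrArg (fun L : E4 →L[ℝ] ℝ => L u) h.fderiv.symm

/-- For a Killing field `X` with Killing form `F` and a parallel field `k`, `F k` is the lowered
Lie bracket `[X, k]`. -/
theorem IsMetricOn.killing_mulVec_eq (hG : IsMetricOn G V) (hy : y ∈ V)
    (hX : ∀ a, DifferentiableAt ℝ (fun z => X z a) y)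
    (hk : ∀ a, DifferentiableAt ℝ (fun z => k z a) y)
    (hkill : ∀ a b, covDerivLower G X y a b + covDerivLower G X y b a = 0)
    (hpar : ∀ a b, covDeriv G k y a b = 0) :
    of (covDerivLower G X y) *ᵥ k y = G y *ᵥ (lieBracket ℝ (fun z => (WithLp.toLp 2 (X z) : E4))
      (fun z => (WithLp.toLp 2 (k z) : E4)) y).ofLp := by
  have hb : ∀ c, (lieBracket ℝ (fun z => (WithLp.toLp 2 (X z) : E4))
      (fun z => (WithLp.toLp 2 (k z) : E4)) y).ofLp c = -∑ a, k y a * covDeriv G X y a c := by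
    intro c
    have h1 : (lieBracket ℝ (fun z => (WithLp.toLp 2 (X z) : E4))
        (fun z => (WithLp.toLp 2 (k z) : E4)) y).ofLp c
        = ∑ a, X y a * pd a (fun z => k z c) y - ∑ a, k y a * pd a (fun z => X z c) y := by
      rw [lieBracket_eq]
      exact congrArg₂ (· - ·) (fderiv_toLp_apply hk _ c) (fderiv_toLp_apply hX _ c)
    have h2 : ∀ a, pd a (fun z => k z c) y = -∑ d, christoffel G y c a d * k y d := fun a =>
      eq_neg_of_add_eq_zero_left (hpar a c)
    rw [h1]
    simp only [h2, covDeriv, mul_neg, Finset.sum_neg_distrib, mul_add, Finset.sum_add_distrib,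
      Finset.mul_sum]
    rw [Finset.sum_comm]
    have h3 : ∀ a d, X y d * (christoffel G y c d a * k y a)
        = k y a * (christoffel G y c a d * X y d) := fun a d => by
      rw [hG.christoffel_symm hy c d a]
      ring
    simp only [h3]
    ring
  ext b
  simp only [mulVec, dotProduct, of_apply, hb]
  -- Antisymmetry of the Killing form moves the contraction to the derivative index, which yields
  -- `-∇_k ξ`; this is `[ξ, k]` because `∇_ξ k = 0`.
  have h4 : ∀ a, covDerivLower G X y b a * k y a = -∑ c, G y b c * (k y a * covDeriv G X y a c) := by
    intro a
    rw [eq_neg_of_add_eq_zero_left (hkill b a), hG.covDerivLower_eq_sum hy hX a b, neg_mul,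
      Finset.sum_mul]
    congr 1
    exact Finset.sum_congr rfl fun c _ => by ring
  simp only [h4, Finset.sum_neg_distrib, mul_neg, Finset.mul_sum]
  rw [Finset.sum_comm]

end Coord

/-! ### Parallel null fields on the manifold: independence of the chart, brackets, proportionality
-/

namespace Spacetime

variable {M : Type*} [TopologicalSpace M] [ChartedSpace E4 M] [IsManifold (𝓡 4) ∞ M]
  {e e' : OpenPartialHomeomorph M E4} {y : E4} {S : Spacetime M}
  {X k ξ : ∀ x : M, TangentSpace (𝓡 4) x}

theorem differentiableAt_vectorComp (he : e ∈ IsManifold.maximalAtlas (𝓡 4) ∞ M)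
    (hy : y ∈ e.target)
    (hX : ContMDiffAt (𝓡 4) (𝓡 4).tangent 3
      (fun x => (⟨x, X x⟩ : TangentBundle (𝓡 4) M)) (e.symm y)) (a : Fin 4) :
    DifferentiableAt ℝ (fun z => vectorComp e X z a) y :=
  differentiableAt_euclidean.mp ((contDiffAt_vectorRep he hy hX).differentiableAt (by norm_num)) a

/-- A vector field that is parallel in one chart is parallel in every chart. -/
theorem covDeriv_eq_zero_of_transition (he : e ∈ IsManifold.maximalAtlas (𝓡 4) ∞ M)
    (he' : e' ∈ IsManifold.maximalAtlas (𝓡 4) ∞ M) (hy : y ∈ e.target)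
    (hy' : e.symm y ∈ e'.source)
    (hk : ContMDiffAt (𝓡 4) (𝓡 4).tangent 3
      (fun x => (⟨x, k x⟩ : TangentBundle (𝓡 4) M)) (e.symm y))
    (hpar : ∀ a b, covDeriv (S.comp e') (vectorComp e' k) (e' (e.symm y)) a b = 0) (a b : Fin 4) :
    covDeriv (S.comp e) (vectorComp e k) y a b = 0 := by
  have hyt : e' (e.symm y) ∈ e'.target := e'.map_source hy'
  have hk' : ContMDiffAt (𝓡 4) (𝓡 4).tangent 3
      (fun x => (⟨x, k x⟩ : TangentBundle (𝓡 4) M)) (e'.symm (e' (e.symm y))) := by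
    rwa [e'.left_inv hy']
  have hlow : ∀ a b, covDerivLower (S.comp e') (vectorComp e' k) (e' (e.symm y)) a b = 0 := by
    intro a b
    rw [(S.isMetricOn_comp he').covDerivLower_eq_sum hyt (differentiableAt_vectorComp he' hyt hk')]
    simp [hpar]
  refine (S.isMetricOn_comp he).covDeriv_eq_zero hy (differentiableAt_vectorComp he hy hk)
    (fun a b => ?_) a b
  have h := covDerivLower_transition (S := S) he he' hy hy' hk (EuclideanSpace.single a 1)
    (EuclideanSpace.single b 1)
  simpa [hlow, Pi.single_apply] using h

/-- Taking components in a chart is the pull-back along its inverse, and the Lie bracket is natural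
under pull-backs. -/
theorem vectorRep_mlieBracket (he : e ∈ IsManifold.maximalAtlas (𝓡 4) ∞ M) (hy : y ∈ e.target)
    (hX : ContMDiffAt (𝓡 4) (𝓡 4).tangent 3
      (fun x => (⟨x, X x⟩ : TangentBundle (𝓡 4) M)) (e.symm y))
    (hk : ContMDiffAt (𝓡 4) (𝓡 4).tangent 3
      (fun x => (⟨x, k x⟩ : TangentBundle (𝓡 4) M)) (e.symm y)) :
    vectorRep e (mlieBracket (𝓡 4) X k) y = lieBracket ℝ (vectorRep e X) (vectorRep e k) y := by
  have : IsManifold (𝓡 4) (minSmoothness ℝ 3) M := IsManifold.of_le (n := ∞) (by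
    rw [minSmoothness_of_isRCLikeNormedField]; norm_cast)
  have h := mpullback_mlieBracket (I := 𝓡 4) (I' := 𝓡 4) (f := e.symm) (x₀ := y) (n := ∞)
    (hX.mdifferentiableAt (by norm_num)) (hk.mdifferentiableAt (by norm_num))
    (contMDiffAt_symm_of_mem_maximalAtlas he hy)
    (by rw [minSmoothness_of_isRCLikeNormedField]; norm_cast)
  have hev : ∀ Y : ∀ x : M, TangentSpace (𝓡 4) x,
      mpullback (𝓡 4) (𝓡 4) e.symm Y =ᶠ[nhds y] vectorRep e Y := fun Y => by
    filter_upwards [e.open_target.mem_nhds hy] with z hz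
    exact inverse_mfderiv_symm_apply he hz _
  have hl : ∀ V W : E4 → E4, mlieBracket (𝓡 4) V W y = lieBracket ℝ V W y := fun V W => by
    rw [← lieBracketWithin_univ]
    exact congrFun (mlieBracketWithin_eq_lieBracketWithin (s := Set.univ)) y
  refine ((hev _).self_of_nhds.symm.trans h).trans ((hl _ _).trans ?_)
  exact (hev X).lieBracket_vectorField_eq (hev k)

/-- A parallel field commutes with a Killing field exactly if it is annihilated by the Killing
form. -/
theorem mlieBracket_eq_zero_iff (hξ : S.IsKilling ξ)
    (he : e ∈ IsManifold.maximalAtlas (𝓡 4) ∞ M) (hy : y ∈ e.target)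
    (hk : ContMDiffAt (𝓡 4) (𝓡 4).tangent 3
      (fun x => (⟨x, k x⟩ : TangentBundle (𝓡 4) M)) (e.symm y))
    (hpar : ∀ a b, covDeriv (S.comp e) (vectorComp e k) y a b = 0) :
    mlieBracket (𝓡 4) ξ k (e.symm y) = 0 ↔
      of (covDerivLower (S.comp e) (vectorComp e ξ) y) *ᵥ vectorComp e k y = 0 := by
  have h := (S.isMetricOn_comp he).killing_mulVec_eq hy
    (differentiableAt_vectorComp he hy (hξ.1 _)) (differentiableAt_vectorComp he hy hk)
    (hξ.2 e he y hy) hpar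
  have hb : (lieBracket ℝ (fun z => (WithLp.toLp 2 (vectorComp e ξ z) : E4))
      (fun z => (WithLp.toLp 2 (vectorComp e k z) : E4)) y)
      = vectorRep e (mlieBracket (𝓡 4) ξ k) y := (vectorRep_mlieBracket he hy (hξ.1 _) hk).symm
  rw [h, hb]
  constructor
  · intro h0
    have h1 : vectorRep e (mlieBracket (𝓡 4) ξ k) y = 0 := by
      rw [vectorRep, h0]
      exact map_zero _
    rw [h1]
    exact mulVec_zero _
  · intro h0
    have h1 := (S.isMetricOn_comp he).eq_zero_of_mulVec_eq_zero hy h0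
    refine eq_of_vectorRep_eq (k := fun _ => 0) he hy ?_
    rw [vectorRep.eq_def e (fun _ => 0)]
    refine Eq.trans ?_ (map_zero _).symm
    ext a
    exact congrFun h1 a

theorem exists_chart (x : M) :
    ∃ e ∈ IsManifold.maximalAtlas (𝓡 4) ∞ M, ∃ y ∈ e.target, e.symm y = x :=
  ⟨chartAt E4 x, IsManifold.chart_mem_maximalAtlas x, chartAt E4 x x, mem_chart_target E4 x,
    (chartAt E4 x).left_inv (mem_chart_source E4 x)⟩

/-- Two null parallel fields that commute with `ξ` are proportional at every common point. -/
theorem IsNullParallelOn.exists_eq_smul (hvac : S.IsVacuum) (hξ : S.IsKilling ξ)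
    (hnull : S.KillingFormNull ξ) (hne : S.KillingFormNowhereZero ξ)
    {Q : M → ℂ} (hQ : S.WeylAligned ξ Q) {U W : Set M} (hU : IsOpen U) (hW : IsOpen W)
    (hk : S.IsNullParallelOn k U) (hX : S.IsNullParallelOn X W) {x : M} (hxU : x ∈ U)
    (hxW : x ∈ W) (hξk : mlieBracket (𝓡 4) ξ k x = 0) (hξX : mlieBracket (𝓡 4) ξ X x = 0) :
    ∃ t : ℝ, k x = t • X x := by
  obtain ⟨e, he, y, hy, rfl⟩ := exists_chart x
  obtain ⟨l, hl⟩ := (isNullAligned hvac hξ hnull hne hQ he).direction y hy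
  -- Commuting with `ξ` means `F k = 0`, and a null vector annihilated by `F` lies on the line of
  -- `l`.
  have key : ∀ {k : ∀ x : M, TangentSpace (𝓡 4) x} {U : Set M}, IsOpen U →
      S.IsNullParallelOn k U → e.symm y ∈ U → mlieBracket (𝓡 4) ξ k (e.symm y) = 0 →
      ∃ c : ℝ, vectorComp e k y = c • l := by
    intro k U hU hk hx hb
    refine hl.exists_smul _ ?_ ?_
    · exact (mlieBracket_eq_zero_iff hξ he hy (hk.contMDiffOn.contMDiffAt (hU.mem_nhds hx))
        (hk.parallel e he y hy hx)).mp hb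
    · have h := S.bilin_comp_vectorRep he hy k k
      rw [hk.null _ hx, bilin_apply_eq_dotProduct] at h
      exact h
  obtain ⟨a, ha⟩ := key hU hk hxU hξk
  obtain ⟨b, hb⟩ := key hW hX hxW hξX
  have hb0 : b ≠ 0 := by
    rintro rfl
    refine hX.ne_zero _ hxW ?_
    rw [← mfderiv_symm_vectorRep he hy X, ← toLp_vectorComp, hb, zero_smul]
    exact map_zero _
  refine ⟨a / b, ?_⟩
  have h1 : vectorRep e k y = (a / b) • vectorRep e X y := by
    rw [← toLp_vectorComp, ← toLp_vectorComp, ha, hb, ← WithLp.toLp_smul, smul_smul,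
      div_mul_cancel₀ _ hb0]
  rw [← mfderiv_symm_vectorRep he hy k, h1, ← mfderiv_symm_vectorRep he hy X]
  exact map_smul _ _ _

end Spacetime

/-! ### Rescaling, gluing and local existence -/

namespace Spacetime

variable {M : Type*} [TopologicalSpace M] [ChartedSpace E4 M] [IsManifold (𝓡 4) ∞ M]
  {S : Spacetime M} {k ξ : ∀ x : M, TangentSpace (𝓡 4) x} {U : Set M}

theorem IsNullParallelOn.const_smul (hU : IsOpen U) (hk : S.IsNullParallelOn k U) {c : ℝ}
    (hc : c ≠ 0) : S.IsNullParallelOn (c • k) U where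
  contMDiffOn := hk.contMDiffOn.const_smul_section
  ne_zero x hx := smul_ne_zero hc (hk.ne_zero x hx)
  null x hx := by
    change S.metric x (c • k x) (c • k x) = 0
    rw [map_smul, map_smul, _root_.smul_apply, hk.null x hx, smul_zero, smul_zero]
  parallel e he y hy hx a b := by
    have hd := differentiableAt_vectorComp he hy (hk.contMDiffOn.contMDiffAt (hU.mem_nhds hx))
    have h1 : ∀ z b, vectorComp e (c • k) z b = c * vectorComp e k z b := fun z b =>
      congrArg (fun v : E4 => v b)
        (map_smul (mfderiv (𝓡 4) (𝓡 4) e (e.symm z)) c (k (e.symm z)))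
    have h2 := hk.parallel e he y hy hx a b
    simp only [covDeriv, h1] at h2 ⊢
    rw [pd_mul a (differentiableAt_const c) (hd b), pd_const, zero_mul, zero_add]
    simp only [mul_left_comm _ c]
    rw [← Finset.mul_sum, ← mul_add, h2, mul_zero]

/-- Being null and parallel is a local property. -/
theorem isNullParallelOn_univ
    (h : ∀ p : M, ∃ U, IsOpen U ∧ p ∈ U ∧ ∃ l, S.IsNullParallelOn l U ∧ ∀ x ∈ U, k x = l x) :
    S.IsNullParallelOn k Set.univ where
  contMDiffOn := by
    intro p _
    obtain ⟨U, hU, hp, l, hl, hkl⟩ := h p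
    refine ((hl.contMDiffOn.contMDiffAt (hU.mem_nhds hp)).congr_of_eventuallyEq
      ?_).contMDiffWithinAt
    filter_upwards [hU.mem_nhds hp] with x hx
    rw [hkl x hx]
  ne_zero p _ := by
    obtain ⟨U, hU, hp, l, hl, hkl⟩ := h p
    rw [hkl p hp]
    exact hl.ne_zero p hp
  null p _ := by
    obtain ⟨U, hU, hp, l, hl, hkl⟩ := h p
    rw [hkl p hp]
    exact hl.null p hp
  parallel e he y hy _ a b := by
    obtain ⟨U, hU, hp, l, hl, hkl⟩ := h (e.symm y)
    rw [← hl.parallel e he y hy hp a b]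
    have hV := e.symm.isOpen_inter_preimage hU
    have hc : ∀ z ∈ e.target ∩ e.symm ⁻¹' U, ∀ b, vectorComp e k z b = vectorComp e l z b :=
      fun z hz b => by rw [vectorComp, vectorComp, hkl _ hz.2]
    rw [covDeriv, covDeriv, pd_congr hV ⟨hy, hp⟩ fun z hz => hc z hz b]
    simp only [hc y ⟨hy, hp⟩]

theorem exists_isNullParallelOn (hvac : S.IsVacuum) (hξ : S.IsKilling ξ)
    (hnull : S.KillingFormNull ξ) (hne : S.KillingFormNowhereZero ξ)
    {Q : M → ℂ} (hQ : S.WeylAligned ξ Q) (p : M) :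
    ∃ U : Set M, IsOpen U ∧ p ∈ U ∧ ∃ (k : ∀ x : M, TangentSpace (𝓡 4) x) (c : ℝ),
      S.IsNullParallelOn k U ∧ (∀ x ∈ U, mlieBracket (𝓡 4) ξ k x = 0) ∧
      (∀ x ∈ U, S.metric x (ξ x) (k x) = c) := by
  obtain ⟨e, he, y, hy, rfl⟩ := exists_chart p
  obtain ⟨r, hr, hball, κ, c, hκ, hκp⟩ :=
    (isNullAligned hvac hξ hnull hne hQ he).exists_parallel hy
  let k : ∀ x : M, TangentSpace (𝓡 4) x := ofComp e fun z => WithLp.toLp 2 (κ z)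
  have hrep : ∀ z ∈ Metric.ball y r, vectorRep e k z = WithLp.toLp 2 (κ z) := fun z hz =>
    vectorRep_ofComp he (hball hz) _
  have hcomp : ∀ z ∈ Metric.ball y r, vectorComp e k z = κ z := fun z hz =>
    congrArg WithLp.ofLp (hrep z hz)
  have hk : ∀ z ∈ Metric.ball y r, ContMDiffAt (𝓡 4) (𝓡 4).tangent 3
      (fun x => (⟨x, k x⟩ : TangentBundle (𝓡 4) M)) (e.symm z) := fun z hz =>
    contMDiffAt_ofComp he (hball hz) (contDiffAt_euclidean.mpr fun a =>
      (hκ a).contDiffAt (Metric.isOpen_ball.mem_nhds hz))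
  have hpar : ∀ z ∈ Metric.ball y r, ∀ a b, covDeriv (S.comp e) (vectorComp e k) z a b = 0 := by
    intro z hz a b
    rw [← (hκp z hz).2.2.1 a b, covDeriv, covDeriv, hcomp z hz,
      pd_congr Metric.isOpen_ball hz fun w hw => congrFun (hcomp w hw) b]
  have hmem : ∀ x ∈ e.source ∩ e ⁻¹' Metric.ball y r, ∃ z ∈ Metric.ball y r, e.symm z = x :=
    fun x hx => ⟨e x, hx.2, e.left_inv hx.1⟩
  refine ⟨e.source ∩ e ⁻¹' Metric.ball y r, e.isOpen_inter_preimage Metric.isOpen_ball,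
    ⟨e.map_target hy, ?_⟩, k, c, ⟨?_, ?_, ?_, ?_⟩, ?_, ?_⟩
  · rw [Set.mem_preimage, e.right_inv hy]
    exact Metric.mem_ball_self hr
  · intro x hx
    obtain ⟨z, hz, rfl⟩ := hmem x hx
    exact (hk z hz).contMDiffWithinAt
  · intro x hx h0
    obtain ⟨z, hz, rfl⟩ := hmem x hx
    refine (hκp z hz).1 ?_
    rw [← hcomp z hz]
    have h1 : vectorRep e k z = 0 := by
      rw [vectorRep, h0]
      exact map_zero _
    exact congrArg WithLp.ofLp h1
  · intro x hx
    obtain ⟨z, hz, rfl⟩ := hmem x hx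
    rw [← S.bilin_comp_vectorRep he (hball hz), hrep z hz, bilin_apply_eq_dotProduct]
    exact (hκp z hz).2.1
  -- The field was built in the single chart `e`; parallelism in every other chart is the covariance
  -- of the lowered derivative.
  · intro e' he' y' hy' hx
    refine covDeriv_eq_zero_of_transition he' he hy' hx.1 ?_ (hpar _ hx.2)
    have := hk _ hx.2
    rwa [e.left_inv hx.1] at this
  · intro x hx
    obtain ⟨z, hz, rfl⟩ := hmem x hx
    refine (mlieBracket_eq_zero_iff hξ he (hball hz) (hk z hz) (hpar z hz)).mpr ?_
    rw [hcomp z hz]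
    exact (hκp z hz).2.2.2.1
  · intro x hx
    obtain ⟨z, hz, rfl⟩ := hmem x hx
    rw [← S.bilin_comp_vectorRep he (hball hz), hrep z hz, bilin_apply_eq_dotProduct]
    exact (hκp z hz).2.2.2.2

end Spacetime

end

/-! ### The theorem: normalization and globalization -/

theorem mainTheorem2 {M : Type*} [TopologicalSpace M] [T2Space M] [SecondCountableTopology M]
    [ConnectedSpace M] [ChartedSpace E4 M] [IsManifold (𝓡 4) ∞ M]
    (S : Spacetime M) (hvac : S.IsVacuum)
    (ξ : ∀ x : M, TangentSpace (𝓡 4) x) (hξ : S.IsKilling ξ)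
    (hnull : S.KillingFormNull ξ) (hne : S.KillingFormNowhereZero ξ)
    (Q : M → ℂ) (hQ : S.WeylAligned ξ Q) :
    (∀ p : M, ∃ U : Set M, IsOpen U ∧ p ∈ U ∧
      ∃ (k : ∀ x : M, TangentSpace (𝓡 4) x) (c : ℝ),
        S.IsNullParallelOn k U ∧
        (∀ x ∈ U, VectorField.mlieBracket (𝓡 4) ξ k x = 0) ∧
        (∀ x ∈ U, S.metric x (ξ x) (k x) = c)) ∧
    (∀ (U : Set M) (k : ∀ x : M, TangentSpace (𝓡 4) x) (c : ℝ),
      IsOpen U → U.Nonempty → S.IsNullParallelOn k U →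
      (∀ x ∈ U, VectorField.mlieBracket (𝓡 4) ξ k x = 0) →
      (∀ x ∈ U, S.metric x (ξ x) (k x) = c) → c ≠ 0 →
      (∃ K : ∀ x : M, TangentSpace (𝓡 4) x,
        S.IsNullParallelOn K Set.univ ∧
        (∀ x, VectorField.mlieBracket (𝓡 4) ξ K x = 0) ∧
        (∀ x, S.metric x (ξ x) (K x) = -1) ∧
        (∀ x ∈ U, K x = (-c⁻¹) • k x)) ∧
      (∀ x, ξ x ≠ 0)) := by
  have hloc := fun p => Spacetime.exists_isNullParallelOn hvac hξ hnull hne hQ p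
  refine ⟨hloc, fun U k c hU hUne hk hξk hkc hc => ?_⟩
  choose W hW hpW l d hl hξl hld using hloc
  -- Each point `x` has its own local field `l x` with constant `d x`. The proportionality factor
  -- `t` may depend on `x`, but pairing with `ξ` gives `c = t * d x`, which determines it once `d x
  -- ≠ 0`.
  have key : ∀ {U : Set M} {k : ∀ x : M, TangentSpace (𝓡 4) x} {c : ℝ}, IsOpen U →
      S.IsNullParallelOn k U → (∀ x ∈ U, VectorField.mlieBracket (𝓡 4) ξ k x = 0) →
      (∀ x ∈ U, S.metric x (ξ x) (k x) = c) → ∀ x ∈ U, ∃ t : ℝ, t ≠ 0 ∧ k x = t • l x x ∧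
        c = t * d x := by
    intro U k c hU hk hξk hkc x hx
    obtain ⟨t, ht⟩ := hk.exists_eq_smul hvac hξ hnull hne hQ hU (hW x) (hl x) hx (hpW x)
      (hξk x hx) (hξl x x (hpW x))
    refine ⟨t, fun h0 => hk.ne_zero x hx (by rw [ht, h0, zero_smul]), ht, ?_⟩
    rw [← hkc x hx, ← hld x x (hpW x), ht, map_smul, smul_eq_mul]
  have hiff : ∀ p, ∀ x ∈ W p, (d p ≠ 0 ↔ d x ≠ 0) := by
    intro p x hx
    obtain ⟨t, ht, -, hd⟩ := key (hW p) (hl p) (hξl p) (hld p) x hx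
    rw [hd]
    simp [ht]
  -- Whether `d` vanishes is locally constant, although `d` itself depends on the arbitrary choice
  -- of the local fields and need not be continuous.
  have hclopen : IsClopen {p | d p ≠ 0} := by
    refine ⟨⟨isOpen_iff_mem_nhds.mpr fun p hp => ?_⟩, isOpen_iff_mem_nhds.mpr fun p hp => ?_⟩
    · filter_upwards [(hW p).mem_nhds (hpW p)] with x hx h
      exact hp ((hiff p x hx).mpr h)
    · filter_upwards [(hW p).mem_nhds (hpW p)] with x hx
      exact (hiff p x hx).mp hp
  have hd : ∀ p, d p ≠ 0 := by
    refine fun p => Set.eq_univ_iff_forall.mp (hclopen.eq_univ ?_) p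
    obtain ⟨x, hx⟩ := hUne
    obtain ⟨t, -, -, ht⟩ := key hU hk hξk hkc x hx
    exact ⟨x, right_ne_zero_of_mul (ht ▸ hc)⟩
  -- The factor `t` cancels between the field and its constant, so the normalized vector at `x` is
  -- the same for every admissible field around `x`. Applied to the chosen fields this yields the
  -- gluing, applied to the given `k` the formula on `U`.
  have hK : ∀ {U : Set M} {k : ∀ x : M, TangentSpace (𝓡 4) x} {c : ℝ}, IsOpen U →
      S.IsNullParallelOn k U → (∀ x ∈ U, VectorField.mlieBracket (𝓡 4) ξ k x = 0) →
      (∀ x ∈ U, S.metric x (ξ x) (k x) = c) → ∀ x ∈ U, (-(d x)⁻¹) • l x x = (-c⁻¹) • k x := by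
    intro U k c hU hk hξk hkc x hx
    obtain ⟨t, ht, hkl, hct⟩ := key hU hk hξk hkc x hx
    rw [hkl, hct, smul_smul]
    congr 1
    have := hd x
    field_simp
  have hmet : ∀ x, S.metric x (ξ x) ((-(d x)⁻¹) • l x x) = -1 := by
    intro x
    rw [map_smul, hld x x (hpW x), smul_eq_mul, neg_mul, inv_mul_cancel₀ (hd x)]
  -- `K` is defined at `x` by the field chosen at `x` itself; near `p` it agrees with the rescaled
  -- `l p`, so the local properties carry over. The last claim holds since `g(ξ, K) = -1` rules out
  -- a zero of `ξ`.
  refine ⟨⟨fun x => (-(d x)⁻¹) • l x x, ?_, ?_, hmet, hK hU hk hξk hkc⟩, fun x h0 => ?_⟩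
  · exact Spacetime.isNullParallelOn_univ fun p => ⟨W p, hW p, hpW p, (-(d p)⁻¹) • l p,
      (hl p).const_smul (hW p) (neg_ne_zero.mpr (inv_ne_zero (hd p))),
      hK (hW p) (hl p) (hξl p) (hld p)⟩
  · intro p
    have : IsManifold (𝓡 4) 2 M := IsManifold.of_le (n := ∞) (by norm_cast)
    have hev : (fun x => (-(d x)⁻¹) • l x x) =ᶠ[nhds p] (-(d p)⁻¹) • l p := by
      filter_upwards [(hW p).mem_nhds (hpW p)] with x hx
      exact hK (hW p) (hl p) (hξl p) (hld p) x hx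
    rw [Filter.EventuallyEq.rfl.mlieBracket_vectorField_eq hev,
      VectorField.mlieBracket_const_smul_right
        (((hl p).contMDiffOn.contMDiffAt ((hW p).mem_nhds (hpW p))).mdifferentiableAt
          (by norm_num)), hξl p p (hpW p), smul_zero]
  · have h := hmet x
    rw [h0, map_zero] at h
    simp at h
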